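/- Let $X$ be a finite family of nonzero vectors of $\mathbb{R}^n$ (the columns of a matrix, repetitions allowed) that spans $\mathbb{R}^n$, let $I\subset X$ be linearly independent, and let $\prec$ be a total order on $X$ in which the elements of $I$ come last ($x\prec y$ for all $x\in X\setminus I$, $y\in I$). Let $\Pi=\mathbb{C}[t_1,\dots,t_n]$, let $\Pi_j^0$ be its subspace of homogeneous polynomials of degree $j$ (including $0$), let $p_x=\sum_k x_kt_k$ for $x\in\mathbb{R}^n$, and $p_Y=\prod_{y\in Y}p_y$. For $A\subset X$ let $\mathcal{P}(A)=\operatorname{span}\{p_Y: Y\subset A,\ \operatorname{rank}(A\setminus Y)=n\}$, and let $$\mathcal{P}_-(X,I)=\bigcap_{b\in I}\mathcal{P}(X\setminus b)\subset\mathcal{P}(X)$$ (read as $\mathcal{P}(X)$ if $I=\emptyset$). A basis $B\subset X$ of $\mathbb{R}^n$ is $I$-internal if there is no $b\in B\cap I$ with $b=\max(X\setminus\operatorname{span}(B\setminus b))$; let $\mathbb{B}_-(X,I)$ be the set of $I$-internal bases. For a basis $B$ let $X(B)=\{x\in X\setminus B: x\notin\operatorname{span}\{b\in B: b\prec x\}\}$,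 $\operatorname{val}(B)=\#X(B)$ and $Q_B=p_{X(B)}$. A facet hyperplane of $X$ is an $(n-1)$-dimensional subspace $F$ spanned by elements of $X$; $\eta_F\neq 0$ is a normal of $F$, and $m(F)=\#(X\setminus F)$. For $B\in\mathbb{B}_-(X,I)$ let $\mathbf{F}$ be the set of the facet hyperplanes $F$ with $\max(X\setminus F)\in I$ and $D_{\eta_F}^{m(F)-1}Q_B\neq0$, where $D_\eta$ is the derivative in direction $\eta$. For $F\in\mathbf{F}$ let $x_F$ be the only element of $X\setminus X(B)$ outside $F$ (see 2). Let $W=\{\max(X\setminus F):F\in\mathbf{F}\}$, and for $w\in W$ let $$X_w=\{x_F: F\in\mathbf{F},\ \max(X\setminus F)=w\},\qquad S_w=\bigcap\{F\in\mathbf{F}:\ \max(X\setminus F)\preceq w\}.$$ Then the following hold. 1. For every $j\ge 0$, $\ h_{-,I}(j):=\dim\bigl(\mathcal{P}_-(X,I)\cap\Pi_j^0\bigr)=\#\{B\in\mathbb{B}_-(X,I):\operatorname{val}(B)=j\}$. 2. For every $B\in\mathbb{B}_-(X,I)$ the elements $x_F$, $F\in\mathbf{F}$, are well defined (exactly one element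 of $X\setminus X(B)$ lies outside $F$), $W\subset X(B)$, and for every $w\in W$ there is a unique vector $w'\in S_w$ such that $w=w'+\sum_{x\in X_w}a_x x$ for some $a_x\in\mathbb{R}\setminus\{0\}$. Hence the polynomial $$\widetilde Q_B:=\prod_{z\in X(B)\setminus W}p_z\ \prod_{w\in W}p_{w'}$$ is well defined. 3. For every $B\in\mathbb{B}_-(X,I)$, $\widetilde Q_B$ is homogeneous and $\deg\widetilde Q_B=\deg Q_B=\operatorname{val}(B)$. 4. The polynomials $\widetilde Q_B$, $B\in\mathbb{B}_-(X,I)$, form a basis of $\mathcal{P}_-(X,I)$. -/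

import Mathlib

namespace Zonotopal

noncomputable section

/-- The linear form `p_x(t) = ∑ x_k t_k` attached to `x ∈ ℝⁿ`, as a complex polynomial. -/
def linForm {n : ℕ} (x : Fin n → ℝ) : MvPolynomial (Fin n) ℂ :=
  ∑ k, MvPolynomial.C (x k : ℂ) * MvPolynomial.X k

/-- The product `p_Y = ∏_{y ∈ Y} p_y` over a set `Y` of columns of `X`. -/
def prodForm {n : ℕ} {ι : Type*} (X : ι → Fin n → ℝ) (Y : Finset ι) :
    MvPolynomial (Fin n) ℂ :=
  ∏ y ∈ Y, linForm (X y)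

/-- The linear span of the columns with index in `A`. -/
def colSpan {n : ℕ} {ι : Type*} (X : ι → Fin n → ℝ) (A : Set ι) :
    Submodule ℝ (Fin n → ℝ) :=
  Submodule.span ℝ (X '' A)

/-- The central space of the submatrix of `X` with columns in `A`: the span of all `p_Y`, `Y ⊆ A`,
for which the columns in `A \ Y` still have rank `n`. -/
def centralSpace {n : ℕ} {ι : Type*} [DecidableEq ι] (X : ι → Fin n → ℝ) (A : Finset ι) :
    Submodule ℂ (MvPolynomial (Fin n) ℂ) :=
  Submodule.span ℂ
    {q | ∃ Y : Finset ι, Y ⊆ A ∧ colSpan X (↑(A \ Y) : Set ι) = ⊤ ∧ q = prodForm X Y}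

/-- The semi-internal space `⋂_{b ∈ I} 𝒫(X \ b)`. The intersection is taken inside `𝒫(X)`, which
contains every `𝒫(X \ b)`; this only matters for `I = ∅`, where the result is `𝒫(X)`. -/
def semiInternalSpace {n : ℕ} {ι : Type*} [Fintype ι] [DecidableEq ι]
    (X : ι → Fin n → ℝ) (I : Finset ι) : Submodule ℂ (MvPolynomial (Fin n) ℂ) :=
  centralSpace X Finset.univ ⊓ ⨅ b ∈ I, centralSpace X (Finset.univ.erase b)

/-- The columns in `B` form a basis of `ℝⁿ`. -/
def IsColBasis {n : ℕ} {ι : Type*} (X : ι → Fin n → ℝ) (B : Finset ι) : Prop :=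
  LinearIndepOn ℝ X (↑B : Set ι) ∧ colSpan X (↑B : Set ι) = ⊤

/-- `w` is the last column of `X` outside of the subspace `F`, i.e. `w = max (X \ F)`. -/
def IsLastOff {n : ℕ} {ι : Type*} [LinearOrder ι] (X : ι → Fin n → ℝ)
    (F : Submodule ℝ (Fin n → ℝ)) (w : ι) : Prop :=
  IsGreatest {x | X x ∉ F} w

/-- `b` is `I`-internally active in `B`. -/
def IsInternallyActive {n : ℕ} {ι : Type*} [LinearOrder ι] (X : ι → Fin n → ℝ)
    (I B : Finset ι) (b : ι) : Prop :=
  b ∈ I ∧ IsLastOff X (colSpan X (↑(B.erase b) : Set ι)) b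

/-- The set of `I`-internal bases. -/
def internalBases {n : ℕ} {ι : Type*} [LinearOrder ι] (X : ι → Fin n → ℝ)
    (I : Finset ι) : Set (Finset ι) :=
  {B | IsColBasis X B ∧ ∀ b ∈ B, ¬ IsInternallyActive X I B b}

open Classical in
/-- `X(B)`: the `x ∈ X \ B` that are not in the span of the elements of `B` preceding `x`. -/
def externalSet {n : ℕ} {ι : Type*} [Fintype ι] [LinearOrder ι] (X : ι → Fin n → ℝ)
    (B : Finset ι) : Finset ι :=
  Finset.univ.filter fun x => x ∉ B ∧ X x ∉ colSpan X {y | y ∈ B ∧ y < x}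

/-- The valuation `val(B) = #X(B)`. -/
def val {n : ℕ} {ι : Type*} [Fintype ι] [LinearOrder ι] (X : ι → Fin n → ℝ)
    (B : Finset ι) : ℕ :=
  (externalSet X B).card

/-- `Q_B = p_{X(B)}`. -/
def polyQ {n : ℕ} {ι : Type*} [Fintype ι] [LinearOrder ι] (X : ι → Fin n → ℝ)
    (B : Finset ι) : MvPolynomial (Fin n) ℂ :=
  prodForm X (externalSet X B)

/-- `F` is a facet hyperplane: of dimension `n - 1` and spanned by columns of `X`. -/
def IsFacet {n : ℕ} {ι : Type*} (X : ι → Fin n → ℝ) (F : Submodule ℝ (Fin n → ℝ)) : Prop :=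
  (∃ Y : Set ι, F = colSpan X Y) ∧ Module.finrank ℝ F + 1 = n

/-- The multiplicity `m(F)`: the number of columns of `X` outside of `F`. -/
def multiplicity {n : ℕ} {ι : Type*} (X : ι → Fin n → ℝ)
    (F : Submodule ℝ (Fin n → ℝ)) : ℕ :=
  {x | X x ∉ F}.ncard

/-- The directional derivative `D_η = p_η(D)`. -/
def dirDeriv {n : ℕ} (η : Fin n → ℝ) (q : MvPolynomial (Fin n) ℂ) : MvPolynomial (Fin n) ℂ :=
  ∑ k, MvPolynomial.C (η k : ℂ) * MvPolynomial.pderiv k q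

/-- The facet hyperplanes `F` with `max (X \ F) ∈ I` and `D_η^{m(F)-1} Q_B ≠ 0`, where `η` is a
normal of `F` (unique up to a nonzero scalar). -/
def badFacets {n : ℕ} {ι : Type*} [Fintype ι] [LinearOrder ι] (X : ι → Fin n → ℝ)
    (I B : Finset ι) : Set (Submodule ℝ (Fin n → ℝ)) :=
  {F | IsFacet X F ∧ (∃ w ∈ I, IsLastOff X F w) ∧
    ∃ η : Fin n → ℝ, η ≠ 0 ∧ (∀ v ∈ F, η ⬝ᵥ v = 0) ∧
      (dirDeriv η)^[multiplicity X F - 1] (polyQ X B) ≠ 0}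

open Classical in
/-- `W = {max (X \ F) : F ∈ badFacets}`. -/
def setW {n : ℕ} {ι : Type*} [Fintype ι] [LinearOrder ι] (X : ι → Fin n → ℝ)
    (I B : Finset ι) : Finset ι :=
  Finset.univ.filter fun w => ∃ F ∈ badFacets X I B, IsLastOff X F w

open Classical in
/-- For `w ∈ W`, the set of all `x_F` with `F ∈ badFacets` and `max (X \ F) = w`. Here `x_F` is
the only element of `X \ X(B)` outside of `F`. -/
def setXF {n : ℕ} {ι : Type*} [Fintype ι] [LinearOrder ι] (X : ι → Fin n → ℝ)
    (I B : Finset ι) (w : ι) : Finset ι :=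
  Finset.univ.filter fun x => ∃ F ∈ badFacets X I B, IsLastOff X F w ∧
    {y | y ∉ externalSet X B ∧ X y ∉ F} = {x}

/-- For `w ∈ W`, the intersection of all `F ∈ badFacets` for which `max (X \ F)` is `w` or
precedes `w`. -/
def spaceS {n : ℕ} {ι : Type*} [Fintype ι] [LinearOrder ι] (X : ι → Fin n → ℝ)
    (I B : Finset ι) (w : ι) : Submodule ℝ (Fin n → ℝ) :=
  sInf {F | F ∈ badFacets X I B ∧ ∃ v ≤ w, IsLastOff X F v}

/-- `v` is the component `w'` in a representation `w = w' + ∑ a_x x` with `w'` in `spaceS`, `x`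
running over `setXF`, and nonzero real coefficients `a_x`. -/
def IsModification {n : ℕ} {ι : Type*} [Fintype ι] [LinearOrder ι] (X : ι → Fin n → ℝ)
    (I B : Finset ι) (w : ι) (v : Fin n → ℝ) : Prop :=
  v ∈ spaceS X I B w ∧ ∃ a : ι → ℝ, (∀ x ∈ setXF X I B w, a x ≠ 0) ∧
    X w = v + ∑ x ∈ setXF X I B w, a x • X x

/-- The vector `w'` (for an `I`-internal basis `B` and `w ∈ W` it exists and is unique). -/
def modVec {n : ℕ} {ι : Type*} [Fintype ι] [LinearOrder ι] (X : ι → Fin n → ℝ)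
    (I B : Finset ι) (w : ι) : Fin n → ℝ :=
  Classical.epsilon (IsModification X I B w)

/-- The modified polynomial: in `Q_B = p_Z p_W`, with `Z = X(B) \ W`, replace each `p_w` by
`p_{w'}`. -/
def polyQmod {n : ℕ} {ι : Type*} [Fintype ι] [LinearOrder ι] (X : ι → Fin n → ℝ)
    (I B : Finset ι) : MvPolynomial (Fin n) ℂ :=
  prodForm X (externalSet X B \ setW X I B) * ∏ w ∈ setW X I B, linForm (modVec X I B w)

end

end Zonotopal

/-! The semi-internal space is cut out by powers of directional derivatives: `p` belongs to it iff,
for every `η ≠ 0` with `m` columns off `η^⊥`, `D_η^m p = 0`, and even `D_η^(m-1) p = 0` when the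
last of these columns is in `I` (`semiInternalSpace_eq_kerSpace`). In this form, `kerSpace`, it
makes sense for any finite set `A` of columns, spanning or not and with zero columns allowed, which
is what an induction needs.

The induction removes the first column `a`, so that last columns and `I` are disturbed as little as
possible. Let `π` have kernel spanned by `X a`. The map `p_x ↦ p_{π x}` sends the kernel space to
that of the contraction, and an element that it kills is `p_a q` with `q` in the kernel space of the
deletion. The modified polynomials obey the same recursion: a basis avoiding `a` acquires the factor
`p_a` (`modPoly_insert`), and a basis containing `a` is carried to its contraction
(`formMap_modPoly`). Independence and spanning follow together
(`linearIndepOn_modPoly_and_kerSpace_le_span`), once the modified polynomials are known to lie in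
the kernel space.

That membership is the combinatorial heart (`card_filter_modCol_lt`): few enough factors of the
modified polynomial may involve `η`. Modification can move factors off `η^⊥`, but each such factor
is paid for by its own basis element off `η^⊥`; in the tight case `exists_compensation` finds a
factor that modification moves onto `η^⊥`.

For `I = ∅` the same induction gives `centralSpace_eq_kerSpace`. Finally, in coordinates of `B`, the
bad facets are the spans of `B \ b` with `b` in some `badSet`, and `w'` is `w` stripped of its
components along `badSet` (`mem_badFacets_iff`, `isModification_iff`). -/

namespace Zonotopal

noncomputable section

/-! ### Powers of a directional derivative on products of linear forms. -/

section LinForm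

variable {n : ℕ}

lemma linForm_add (x y : Fin n → ℝ) : linForm (x + y) = linForm x + linForm y := by
  simp [linForm, add_mul, Finset.sum_add_distrib]

lemma linForm_smul (a : ℝ) (x : Fin n → ℝ) :
    linForm (a • x) = MvPolynomial.C (a : ℂ) * linForm x := by
  simp [linForm, Finset.mul_sum, mul_assoc]

@[simp] lemma linForm_zero : linForm (0 : Fin n → ℝ) = 0 := by
  simp [linForm]

lemma linForm_single (k : Fin n) : linForm (Pi.single k 1) = MvPolynomial.X k := by
  classical
  rw [linForm, Finset.sum_eq_single k]
  · simp
  · intro b _ hb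
    simp [Pi.single_eq_of_ne hb]
  · simp

lemma linForm_isHomogeneous (x : Fin n → ℝ) : (linForm x).IsHomogeneous 1 := by
  refine MvPolynomial.IsHomogeneous.sum _ _ _ fun k _ => ?_
  simpa using (MvPolynomial.isHomogeneous_C (Fin n) (x k : ℂ)).mul
    (MvPolynomial.isHomogeneous_X ℂ k)

/-- The directional derivative as an endomorphism. -/
def dirEnd (η : Fin n → ℝ) : Module.End ℂ (MvPolynomial (Fin n) ℂ) :=
  ((∑ k, MvPolynomial.C (σ := Fin n) (η k : ℂ) • MvPolynomial.pderiv k :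
    Derivation ℂ (MvPolynomial (Fin n) ℂ) (MvPolynomial (Fin n) ℂ)) : _ →ₗ[ℂ] _)

lemma dirEnd_apply (η : Fin n → ℝ) (q : MvPolynomial (Fin n) ℂ) :
    dirEnd η q = dirDeriv η q := by
  have h := congrFun (map_sum Derivation.coeFnAddMonoidHom (fun k =>
    MvPolynomial.C (σ := Fin n) (η k : ℂ) • MvPolynomial.pderiv k) Finset.univ) q
  rw [Finset.sum_apply] at h
  simp only [Derivation.coeFnAddMonoidHom_apply] at h
  simp only [dirEnd, dirDeriv, Derivation.coeFn_coe, h, Derivation.coe_smul, Pi.smul_apply,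
    smul_eq_mul]

lemma dirEnd_mul (η : Fin n → ℝ) (p q : MvPolynomial (Fin n) ℂ) :
    dirEnd η (p * q) = p * dirEnd η q + dirEnd η p * q := by
  simp only [dirEnd, Derivation.coeFn_coe, Derivation.leibniz, smul_eq_mul]
  ring

lemma dirEnd_X (η : Fin n → ℝ) (k : Fin n) :
    dirEnd η (MvPolynomial.X k) = MvPolynomial.C (η k : ℂ) := by
  classical
  rw [dirEnd_apply, dirDeriv, Finset.sum_eq_single k]
  · simp
  · intro b _ hb
    simp [MvPolynomial.pderiv_X_of_ne hb.symm]
  · simp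

lemma dirEnd_C (η : Fin n → ℝ) (a : ℂ) : dirEnd η (MvPolynomial.C a) = 0 := by
  simp [dirEnd_apply, dirDeriv]

lemma dirEnd_linForm (η x : Fin n → ℝ) :
    dirEnd η (linForm x) = MvPolynomial.C ((η ⬝ᵥ x : ℝ) : ℂ) := by
  simp [linForm, dirEnd_mul, dirEnd_X, dirEnd_C, dotProduct, mul_comm]

lemma dirEnd_pow_succ (η : Fin n → ℝ) (k : ℕ) (q : MvPolynomial (Fin n) ℂ) :
    (dirEnd η ^ (k + 1)) q = dirEnd η ((dirEnd η ^ k) q) := by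
  rw [pow_succ', Module.End.mul_apply]

lemma dirEnd_pow_eq_zero_of_le (η : Fin n → ℝ) {k l : ℕ} (h : k ≤ l)
    {q : MvPolynomial (Fin n) ℂ} (hq : (dirEnd η ^ k) q = 0) : (dirEnd η ^ l) q = 0 := by
  obtain ⟨m, rfl⟩ := Nat.exists_eq_add_of_le' h
  rw [pow_add, Module.End.mul_apply, hq, map_zero]

lemma dirEnd_pow_succ_linForm_mul (η x : Fin n → ℝ) (k : ℕ) (q : MvPolynomial (Fin n) ℂ) :
    (dirEnd η ^ (k + 1)) (linForm x * q) = linForm x * (dirEnd η ^ (k + 1)) q +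
      MvPolynomial.C (((k + 1 : ℕ) : ℂ) * ((η ⬝ᵥ x : ℝ) : ℂ)) * (dirEnd η ^ k) q := by
  induction k with
  | zero => simp [dirEnd_mul, dirEnd_linForm]
  | succ k ih =>
    rw [dirEnd_pow_succ η (k + 1), ih, map_add, dirEnd_mul, dirEnd_mul, dirEnd_linForm, dirEnd_C,
      ← dirEnd_pow_succ, ← dirEnd_pow_succ]
    push_cast
    simp only [map_add, map_mul, map_one]
    ring

lemma dirEnd_pow_linForm_mul_of_dotProduct_eq_zero {η x : Fin n → ℝ} (h : η ⬝ᵥ x = 0) (k : ℕ)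
    (q : MvPolynomial (Fin n) ℂ) :
    (dirEnd η ^ k) (linForm x * q) = linForm x * (dirEnd η ^ k) q := by
  cases k with
  | zero => simp
  | succ k => simp [dirEnd_pow_succ_linForm_mul, h]

lemma exists_dirEnd_pow_eq_zero (η : Fin n → ℝ) (q : MvPolynomial (Fin n) ℂ) :
    ∃ k, (dirEnd η ^ k) q = 0 := by
  induction q using MvPolynomial.induction_on with
  | C a => exact ⟨1, by simp [dirEnd_C]⟩
  | add p q hp hq =>
    obtain ⟨k, hk⟩ := hp
    obtain ⟨l, hl⟩ := hq
    refine ⟨max k l, ?_⟩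
    rw [map_add, dirEnd_pow_eq_zero_of_le η (le_max_left k l) hk,
      dirEnd_pow_eq_zero_of_le η (le_max_right k l) hl, add_zero]
  | mul_X p i hp =>
    obtain ⟨k, hk⟩ := hp
    refine ⟨k + 1, ?_⟩
    rw [mul_comm, ← linForm_single, dirEnd_pow_succ_linForm_mul, hk,
      dirEnd_pow_eq_zero_of_le η (Nat.le_succ k) hk]
    simp

/-- Some high power of `D_η` kills `q`. The Leibniz formula for `D_η^(k+d+1) (p_x q)` then lowers
the exponent one step at a time, down to `k`. -/
lemma dirEnd_pow_eq_zero_of_linForm_mul {η x : Fin n → ℝ} (h : η ⬝ᵥ x ≠ 0) {k : ℕ}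
    {q : MvPolynomial (Fin n) ℂ} (hq : (dirEnd η ^ (k + 1)) (linForm x * q) = 0) :
    (dirEnd η ^ k) q = 0 := by
  obtain ⟨N, hN⟩ := exists_dirEnd_pow_eq_zero η q
  have key : ∀ d, (dirEnd η ^ (k + d)) q = 0 → (dirEnd η ^ k) q = 0 := by
    intro d
    induction d with
    | zero => exact id
    | succ d ih =>
      intro hd
      apply ih
      have h1 := dirEnd_pow_succ_linForm_mul η x (k + d) q
      rw [dirEnd_pow_eq_zero_of_le η (by omega) hq, add_assoc, hd, mul_zero, zero_add] at h1
      refine (mul_eq_zero.mp h1.symm).resolve_left ?_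
      rw [MvPolynomial.C_eq_zero]
      exact mul_ne_zero (Nat.cast_ne_zero.mpr (by omega)) (by exact_mod_cast h)
  exact key N (dirEnd_pow_eq_zero_of_le η (by omega) hN)

lemma linForm_ne_zero {x : Fin n → ℝ} (hx : x ≠ 0) : linForm x ≠ 0 := by
  intro h
  have h1 := dirEnd_linForm x x
  rw [h, map_zero, eq_comm, MvPolynomial.C_eq_zero] at h1
  exact hx (dotProduct_self_eq_zero.mp (by exact_mod_cast h1))

lemma dirEnd_pow_prod_eq_zero {ι : Type*} (η : Fin n → ℝ) (v : ι → Fin n → ℝ) (s : Finset ι)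
    {k : ℕ} (hk : (s.filter fun i => η ⬝ᵥ v i ≠ 0).card < k) :
    (dirEnd η ^ k) (∏ i ∈ s, linForm (v i)) = 0 := by
  classical
  induction s using Finset.induction_on generalizing k with
  | empty =>
    obtain ⟨k, rfl⟩ := Nat.exists_eq_succ_of_ne_zero (Nat.ne_of_gt hk)
    rw [Finset.prod_empty, pow_succ, Module.End.mul_apply, ← MvPolynomial.C_1, dirEnd_C, map_zero]
  | insert a s ha ih =>
    rw [Finset.prod_insert ha]
    rw [Finset.filter_insert] at hk
    split_ifs at hk with h
    · rw [Finset.card_insert_of_notMem (by simp [ha])] at hk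
      obtain ⟨k, rfl⟩ := Nat.exists_eq_succ_of_ne_zero (Nat.ne_zero_of_lt hk)
      rw [Nat.succ_eq_add_one, dirEnd_pow_succ_linForm_mul, ih (by omega), ih (by omega)]
      simp
    · rw [dirEnd_pow_linForm_mul_of_dotProduct_eq_zero (not_not.mp h), ih hk, mul_zero]

lemma dirEnd_pow_prod_ne_zero {ι : Type*} (η : Fin n → ℝ) (v : ι → Fin n → ℝ) (s : Finset ι)
    (hv : ∀ i ∈ s, v i ≠ 0) {k : ℕ} (hk : k ≤ (s.filter fun i => η ⬝ᵥ v i ≠ 0).card) :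
    (dirEnd η ^ k) (∏ i ∈ s, linForm (v i)) ≠ 0 := by
  classical
  induction s using Finset.induction_on generalizing k with
  | empty =>
    obtain rfl : k = 0 := by simpa using hk
    simp
  | insert a s ha ih =>
    have hs : ∀ i ∈ s, v i ≠ 0 := fun i hi => hv i (Finset.mem_insert_of_mem hi)
    have hva := linForm_ne_zero (hv a (Finset.mem_insert_self a s))
    rw [Finset.prod_insert ha]
    rw [Finset.filter_insert] at hk
    split_ifs at hk with h
    · rw [Finset.card_insert_of_notMem (by simp [ha])] at hk
      cases k with
      | zero => simpa using mul_ne_zero hva (by simpa using ih hs (Nat.zero_le _))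
      | succ k => exact fun h0 => ih hs (by omega) (dirEnd_pow_eq_zero_of_linForm_mul h h0)
    · rw [dirEnd_pow_linForm_mul_of_dotProduct_eq_zero (not_not.mp h)]
      exact mul_ne_zero hva (ih hs hk)

end LinForm

/-! ### Contraction of the polynomial ring along a vector. -/

section Contraction

variable {n m : ℕ}

/-- The homomorphism of polynomial rings that sends `p_x` to `p_{π x}`. -/
def formMap (π : (Fin n → ℝ) →ₗ[ℝ] (Fin m → ℝ)) :
    MvPolynomial (Fin n) ℂ →ₐ[ℂ] MvPolynomial (Fin m) ℂ :=
  MvPolynomial.aeval fun k => linForm (π (Pi.single k 1))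

lemma formMap_linForm (π : (Fin n → ℝ) →ₗ[ℝ] (Fin m → ℝ)) (x : Fin n → ℝ) :
    formMap π (linForm x) = linForm (π x) := by
  have h : ∀ (s : Finset (Fin n)) (f : Fin n → Fin m → ℝ),
      linForm (∑ k ∈ s, f k) = ∑ k ∈ s, linForm (f k) := by
    classical
    intro s f
    induction s using Finset.induction_on with
    | empty => simp
    | insert a s ha ih => rw [Finset.sum_insert ha, Finset.sum_insert ha, linForm_add, ih]
  conv_rhs => rw [pi_eq_sum_univ' x, map_sum, h]
  simp only [map_smul, linForm_smul]
  conv_lhs => rw [linForm]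
  simp [formMap]

lemma formMap_dirEnd (π : (Fin n → ℝ) →ₗ[ℝ] (Fin m → ℝ)) {η : Fin n → ℝ} {θ : Fin m → ℝ}
    (h : ∀ x, η ⬝ᵥ x = θ ⬝ᵥ π x) (q : MvPolynomial (Fin n) ℂ) :
    formMap π (dirEnd η q) = dirEnd θ (formMap π q) := by
  induction q using MvPolynomial.induction_on with
  | C a => simp [dirEnd_C, formMap]
  | add p q hp hq => simp [hp, hq]
  | mul_X p i hp =>
    rw [← linForm_single]
    simp only [dirEnd_mul, map_mul, map_add, formMap_linForm, dirEnd_linForm, h, hp]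
    simp [formMap]

lemma formMap_dirEnd_pow (π : (Fin n → ℝ) →ₗ[ℝ] (Fin m → ℝ)) {η : Fin n → ℝ} {θ : Fin m → ℝ}
    (h : ∀ x, η ⬝ᵥ x = θ ⬝ᵥ π x) (k : ℕ) (q : MvPolynomial (Fin n) ℂ) :
    formMap π ((dirEnd η ^ k) q) = (dirEnd θ ^ k) (formMap π q) := by
  induction k with
  | zero => simp
  | succ k ih => rw [dirEnd_pow_succ, dirEnd_pow_succ, formMap_dirEnd π h, ih]

/-- For a linear section `σ` of `π`, the map `x ↦ x - σ (π x)` takes values in the line of `a`;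
hence every `q` agrees with its image under `σ ∘ π` modulo `p_a`. -/
lemma linForm_dvd_of_formMap_eq_zero (π : (Fin n → ℝ) →ₗ[ℝ] (Fin m → ℝ))
    (hπ : Function.Surjective π) {a : Fin n → ℝ} (ha : LinearMap.ker π = Submodule.span ℝ {a})
    {q : MvPolynomial (Fin n) ℂ} (hq : formMap π q = 0) : linForm a ∣ q := by
  obtain ⟨σ, hσ⟩ := π.exists_rightInverse_of_surjective (LinearMap.range_eq_top.mpr hπ)
  have key : linForm a ∣ q - formMap σ (formMap π q) := by
    clear hq
    induction q using MvPolynomial.induction_on with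
    | C b => simp [formMap]
    | add p q hp hq =>
      have := dvd_add hp hq
      simp only [map_add]
      convert this using 1
      ring
    | mul_X p i hp =>
      rw [← linForm_single]
      simp only [map_mul, formMap_linForm]
      have hx : Pi.single i 1 - σ (π (Pi.single i 1)) ∈ LinearMap.ker π := by
        rw [LinearMap.mem_ker, map_sub, sub_eq_zero]
        exact (LinearMap.congr_fun hσ (π (Pi.single i 1))).symm
      rw [ha, Submodule.mem_span_singleton] at hx
      obtain ⟨c, hc⟩ := hx
      have h1 : linForm (Pi.single i (1 : ℝ)) =
          linForm (σ (π (Pi.single i 1))) + MvPolynomial.C (c : ℂ) * linForm a := by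
        rw [← linForm_smul, ← linForm_add, hc]
        simp
      have : p * linForm (Pi.single i (1 : ℝ)) -
          formMap σ (formMap π p) * linForm (σ (π (Pi.single i 1))) =
          (p - formMap σ (formMap π p)) * linForm (σ (π (Pi.single i 1))) +
            linForm a * (MvPolynomial.C (c : ℂ) * p) := by
        rw [h1]; ring
      rw [this]
      exact dvd_add (Dvd.dvd.mul_right hp _) (dvd_mul_right _ _)
  simpa [hq] using key

lemma exists_linearMap_ker_eq_span_singleton {a : Fin (n + 1) → ℝ} (ha : a ≠ 0) :
    ∃ π : (Fin (n + 1) → ℝ) →ₗ[ℝ] (Fin n → ℝ), Function.Surjective π ∧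
      LinearMap.ker π = Submodule.span ℝ {a} := by
  have h : Module.finrank ℝ ((Fin (n + 1) → ℝ) ⧸ Submodule.span ℝ {a}) =
      Module.finrank ℝ (Fin n → ℝ) := by
    have := Submodule.finrank_quotient_add_finrank (Submodule.span ℝ {a})
    rw [finrank_span_singleton ha] at this
    simpa using this
  let e := LinearEquiv.ofFinrankEq _ _ h
  refine ⟨e.toLinearMap ∘ₗ (Submodule.span ℝ {a}).mkQ, ?_, ?_⟩
  · exact e.surjective.comp (Submodule.mkQ_surjective _)
  · rw [LinearEquiv.ker_comp, Submodule.ker_mkQ]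

end Contraction

/-! ### Coordinates with respect to a basis of columns, and their behaviour under contraction. -/

section Coordinates

variable {n : ℕ} {ι : Type*} [DecidableEq ι] {X : ι → Fin n → ℝ} {B : Finset ι}

/-- The coefficients of `v` with respect to the columns in `B`. -/
def coeffs (X : ι → Fin n → ℝ) (B : Finset ι) (v : Fin n → ℝ) : ι → ℝ :=
  Classical.epsilon fun c => (∀ b ∉ B, c b = 0) ∧ ∑ b ∈ B, c b • X b = v

lemma mem_colSpan_iff (X : ι → Fin n → ℝ) (S : Finset ι) (v : Fin n → ℝ) :
    v ∈ colSpan X (↑S : Set ι) ↔ ∃ c : ι → ℝ, (∀ b ∉ S, c b = 0) ∧ ∑ b ∈ S, c b • X b = v := by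
  rw [colSpan, Submodule.mem_span_image_finset_iff_exists_fun']
  constructor
  · rintro ⟨c, hc⟩
    refine ⟨fun b => if b ∈ S then c b else 0, fun b hb => if_neg hb, ?_⟩
    rw [← hc]
    exact Finset.sum_congr rfl fun b hb => by simp [hb]
  · rintro ⟨c, -, hc⟩
    exact ⟨c, hc⟩

lemma coeffs_spec (hB : IsColBasis X B) (v : Fin n → ℝ) :
    (∀ b ∉ B, coeffs X B v b = 0) ∧ ∑ b ∈ B, coeffs X B v b • X b = v := by
  have h : v ∈ colSpan X (↑B : Set ι) := by rw [hB.2]; trivial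
  exact Classical.epsilon_spec ((mem_colSpan_iff X B v).mp h)

lemma sum_coeffs (hB : IsColBasis X B) (v : Fin n → ℝ) :
    ∑ b ∈ B, coeffs X B v b • X b = v := (coeffs_spec hB v).2

lemma coeffs_of_notMem (hB : IsColBasis X B) (v : Fin n → ℝ) {b : ι} (hb : b ∉ B) :
    coeffs X B v b = 0 := (coeffs_spec hB v).1 b hb

lemma coeffs_sum (hB : IsColBasis X B) {c : ι → ℝ} (hc : ∀ b ∉ B, c b = 0) :
    coeffs X B (∑ b ∈ B, c b • X b) = c := by
  funext b
  by_cases hb : b ∈ B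
  · have h := linearIndepOn_finset_iff.mp hB.1
      (fun b => coeffs X B (∑ b ∈ B, c b • X b) b - c b) (by
        simp only [sub_smul, Finset.sum_sub_distrib, sum_coeffs hB, sub_self]) b hb
    exact sub_eq_zero.mp h
  · rw [coeffs_of_notMem hB _ hb, hc b hb]

lemma coeffs_eq (hB : IsColBasis X B) {c : ι → ℝ} (hc : ∀ b ∉ B, c b = 0) {v : Fin n → ℝ}
    (h : ∑ b ∈ B, c b • X b = v) : coeffs X B v = c := by
  rw [← h, coeffs_sum hB hc]

lemma coeffs_self (hB : IsColBasis X B) {b : ι} (hb : b ∈ B) :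
    coeffs X B (X b) = Pi.single b 1 := by
  refine coeffs_eq hB (fun b' hb' => Pi.single_eq_of_ne (ne_of_mem_of_not_mem hb hb').symm _) ?_
  rw [Finset.sum_eq_single b]
  · simp
  · intro b' _ h
    simp [Pi.single_eq_of_ne h]
  · exact fun h => (h hb).elim

lemma coeffs_add (hB : IsColBasis X B) (v w : Fin n → ℝ) :
    coeffs X B (v + w) = coeffs X B v + coeffs X B w := by
  refine coeffs_eq hB (fun b hb => ?_) ?_
  · simp [coeffs_of_notMem hB _ hb]
  · simp [add_smul, Finset.sum_add_distrib, sum_coeffs hB]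

lemma coeffs_smul (hB : IsColBasis X B) (a : ℝ) (v : Fin n → ℝ) :
    coeffs X B (a • v) = a • coeffs X B v := by
  refine coeffs_eq hB (fun b hb => ?_) ?_
  · simp [coeffs_of_notMem hB _ hb]
  · simp [mul_smul, ← Finset.smul_sum, sum_coeffs hB]

lemma mem_colSpan_iff_coeffs (hB : IsColBasis X B) {S : Set ι} (hS : S ⊆ B) (v : Fin n → ℝ) :
    v ∈ colSpan X S ↔ ∀ b ∈ B, b ∉ S → coeffs X B v b = 0 := by
  classical
  obtain ⟨T, rfl⟩ : ∃ T : Finset ι, (↑T : Set ι) = S :=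
    ⟨(B.finite_toSet.subset hS).toFinset, by simp⟩
  have hTB : T ⊆ B := by exact_mod_cast hS
  rw [mem_colSpan_iff]
  constructor
  · rintro ⟨c, hc, h⟩ b _ hb
    rw [coeffs_eq hB (c := c) (fun b hb => hc b fun h => hb (hTB h))
      ((Finset.sum_subset hTB fun b _ hb => by simp [hc b hb]).symm.trans h)]
    exact hc b hb
  · intro h
    have h0 : ∀ b ∉ T, coeffs X B v b = 0 := fun b hb => by
      by_cases hbB : b ∈ B
      · exact h b hbB (by simpa using hb)
      · exact coeffs_of_notMem hB v hbB
    refine ⟨coeffs X B v, h0, ?_⟩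
    conv_rhs => rw [← sum_coeffs hB v]
    exact Finset.sum_subset hTB fun b _ hb => by simp [h0 b hb]

lemma mem_colSpan_erase_iff (hB : IsColBasis X B) {b : ι} (hb : b ∈ B) (v : Fin n → ℝ) :
    v ∈ colSpan X (↑(B.erase b) : Set ι) ↔ coeffs X B v b = 0 := by
  rw [mem_colSpan_iff_coeffs hB (by exact_mod_cast Finset.erase_subset b B)]
  constructor
  · exact fun h => h b hb (by simp)
  · intro h b' hb' hb''
    obtain rfl : b' = b := by
      by_contra hne
      exact hb'' (by simp [hne, hb'])
    exact h

lemma dotProduct_eq_sum_coeffs (hB : IsColBasis X B) (η v : Fin n → ℝ) :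
    η ⬝ᵥ v = ∑ b ∈ B, coeffs X B v b * (η ⬝ᵥ X b) := by
  conv_lhs => rw [← sum_coeffs hB v]
  simp [dotProduct_sum, dotProduct_smul]

lemma exists_dotProduct_eq (f : (Fin n → ℝ) →ₗ[ℝ] ℝ) : ∃ η : Fin n → ℝ, ∀ v, η ⬝ᵥ v = f v := by
  refine ⟨fun i => f (Pi.single i 1), fun v => ?_⟩
  conv_rhs => rw [pi_eq_sum_univ' v, map_sum]
  simp [dotProduct, mul_comm]

lemma exists_dotProduct_eq_coeffs (hB : IsColBasis X B) (b : ι) :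
    ∃ η : Fin n → ℝ, ∀ v, η ⬝ᵥ v = coeffs X B v b :=
  exists_dotProduct_eq
    { toFun := fun v => coeffs X B v b
      map_add' := fun v w => by rw [coeffs_add hB]; rfl
      map_smul' := fun a v => by rw [coeffs_smul hB]; rfl }

lemma exists_dotProduct_ne_zero_of_isColBasis (hB : IsColBasis X B) {η : Fin n → ℝ} (hη : η ≠ 0) :
    ∃ b ∈ B, η ⬝ᵥ X b ≠ 0 := by
  by_contra! h
  refine hη (dotProduct_self_eq_zero.mp ?_)
  rw [dotProduct_eq_sum_coeffs hB]
  exact Finset.sum_eq_zero fun b hb => by simp [h b hb]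

lemma isColBasis_of_coeffs {κ : Type*} {X : κ → Fin n → ℝ} {B : Finset κ}
    (h1 : ∀ c : κ → ℝ, ∑ b ∈ B, c b • X b = 0 → ∀ b ∈ B, c b = 0)
    (h2 : ∀ v, ∃ c : κ → ℝ, ∑ b ∈ B, c b • X b = v) : IsColBasis X B := by
  refine ⟨linearIndepOn_finset_iff.mpr h1, eq_top_iff.mpr fun v _ => ?_⟩
  obtain ⟨c, hc⟩ := h2 v
  rw [← hc]
  exact Submodule.sum_mem _ fun b hb =>
    Submodule.smul_mem _ _ (Submodule.subset_span (Set.mem_image_of_mem X hb))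

variable {m : ℕ} {π : (Fin n → ℝ) →ₗ[ℝ] (Fin m → ℝ)} {a : ι}

lemma isColBasis_insert (hπ : LinearMap.ker π = Submodule.span ℝ {X a}) (hXa : X a ≠ 0)
    (ha : a ∉ B) (hB : IsColBasis (fun x => π (X x)) B) : IsColBasis X (insert a B) := by
  have hpa : π (X a) = 0 := by
    rw [← LinearMap.mem_ker, hπ]; exact Submodule.mem_span_singleton_self _
  apply isColBasis_of_coeffs
  · intro c hc
    rw [Finset.sum_insert ha] at hc
    have h0 : ∀ b ∈ B, c b = 0 := by
      refine linearIndepOn_finset_iff.mp hB.1 c ?_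
      simpa [hpa] using congrArg π hc
    rw [Finset.sum_eq_zero fun b hb => by rw [h0 b hb, zero_smul], add_zero] at hc
    exact Finset.forall_mem_insert _ _ _ |>.mpr
      ⟨(smul_eq_zero.mp hc).resolve_right hXa, h0⟩
  · intro v
    have hk : v - ∑ b ∈ B, coeffs (fun x => π (X x)) B (π v) b • X b ∈ LinearMap.ker π := by
      rw [LinearMap.mem_ker, map_sub, map_sum]
      simp only [map_smul]
      rw [sum_coeffs hB, sub_self]
    rw [hπ, Submodule.mem_span_singleton] at hk
    obtain ⟨r, hr⟩ := hk
    refine ⟨fun b => if b = a then r else coeffs (fun x => π (X x)) B (π v) b, ?_⟩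
    have h : ∀ b ∈ B, (if b = a then r else coeffs (fun x => π (X x)) B (π v) b) • X b =
        coeffs (fun x => π (X x)) B (π v) b • X b := fun b hb => by
      rw [if_neg (ne_of_mem_of_not_mem hb ha)]
    simp only
    rw [Finset.sum_insert ha, if_pos rfl, hr, Finset.sum_congr rfl h, sub_add_cancel]

lemma isColBasis_erase (hs : Function.Surjective π)
    (hπ : LinearMap.ker π = Submodule.span ℝ {X a}) (ha : a ∈ B)
    (hB : IsColBasis X B) : IsColBasis (fun x => π (X x)) (B.erase a) := by
  have hpa : π (X a) = 0 := by
    rw [← LinearMap.mem_ker, hπ]; exact Submodule.mem_span_singleton_self _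
  apply isColBasis_of_coeffs
  · intro c hc b hb
    have hk : ∑ b ∈ B.erase a, c b • X b ∈ LinearMap.ker π := by
      simpa using hc
    rw [hπ, Submodule.mem_span_singleton] at hk
    obtain ⟨r, hr⟩ := hk
    have := linearIndepOn_finset_iff.mp hB.1 (fun b => if b = a then -r else c b) (by
      rw [← Finset.add_sum_erase _ _ ha, if_pos rfl, Finset.sum_congr rfl fun b hb => by
        rw [if_neg (Finset.ne_of_mem_erase hb)], ← hr, neg_smul, neg_add_cancel]) b
        (Finset.mem_of_mem_erase hb)
    simpa [Finset.ne_of_mem_erase hb] using this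
  · intro v
    obtain ⟨v, rfl⟩ := hs v
    refine ⟨coeffs X B v, ?_⟩
    conv_rhs => rw [← sum_coeffs hB v, map_sum, ← Finset.add_sum_erase _ _ ha]
    simp [hpa]

/-- Contracting `a ∈ B` only forgets the coordinate at `a`, so all the data read off from the other
coordinates survive. -/
lemma coeffs_erase (hs : Function.Surjective π)
    (hπ : LinearMap.ker π = Submodule.span ℝ {X a}) (ha : a ∈ B)
    (hB : IsColBasis X B) (v : Fin n → ℝ) {b : ι} (hb : b ≠ a) :
    coeffs (fun x => π (X x)) (B.erase a) (π v) b = coeffs X B v b := by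
  have hpa : π (X a) = 0 := by
    rw [← LinearMap.mem_ker, hπ]; exact Submodule.mem_span_singleton_self _
  rw [coeffs_eq (isColBasis_erase hs hπ ha hB)
    (c := fun b => if b = a then 0 else coeffs X B v b)]
  · simp [hb]
  · intro b hb
    by_cases h : b = a
    · simp [h]
    · rw [if_neg h, coeffs_of_notMem hB v fun hbB => hb (Finset.mem_erase.mpr ⟨h, hbB⟩)]
  · conv_rhs => rw [← sum_coeffs hB v, map_sum, ← Finset.add_sum_erase _ _ ha]
    rw [map_smul, hpa, smul_zero, zero_add]
    exact Finset.sum_congr rfl fun b hb => by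
      rw [if_neg (Finset.ne_of_mem_erase hb), map_smul]

end Coordinates

/-! ### The kernel space, the modified polynomials, and the counting that places the latter in the
former. -/

section Relative

variable {n : ℕ} {ι : Type*} [LinearOrder ι]

/-- The columns in `A` outside of the hyperplane orthogonal to `η`. -/
def offSet (X : ι → Fin n → ℝ) (A : Finset ι) (η : Fin n → ℝ) : Finset ι :=
  A.filter fun y => η ⬝ᵥ X y ≠ 0

/-- The polynomials killed by `D_η ^ m(η)` and, if the last column off the hyperplane orthogonal
to `η` is in `I`, even by `D_η ^ (m(η) - 1)`, where `m(η)` counts the columns in `A` off it. -/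
def kerSpace (X : ι → Fin n → ℝ) (A I : Finset ι) :
    Submodule ℂ (MvPolynomial (Fin n) ℂ) where
  carrier := {p | ∀ η : Fin n → ℝ, η ≠ 0 → (dirEnd η ^ (offSet X A η).card) p = 0 ∧
    ((∃ w ∈ I, IsGreatest (↑(offSet X A η) : Set ι) w) →
      (dirEnd η ^ ((offSet X A η).card - 1)) p = 0)}
  add_mem' := fun hp hq η hη =>
    ⟨by rw [map_add, (hp η hη).1, (hq η hη).1, add_zero],
      fun h => by rw [map_add, (hp η hη).2 h, (hq η hη).2 h, add_zero]⟩
  zero_mem' := fun η _ => by simp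
  smul_mem' := fun a p hp η hη =>
    ⟨by rw [map_smul, (hp η hη).1, smul_zero],
      fun h => by rw [map_smul, (hp η hη).2 h, smul_zero]⟩

/-- The columns in `A` whose expansion in the basis `B` involves `b`. -/
def cocircuit (X : ι → Fin n → ℝ) (A B : Finset ι) (b : ι) : Finset ι :=
  A.filter fun y => coeffs X B (X y) b ≠ 0

/-- The columns in `A \ B` that are not in the span of the preceding elements of `B`. -/
def extSet (X : ι → Fin n → ℝ) (A B : Finset ι) : Finset ι :=
  A.filter fun y => y ∉ B ∧ ∃ b ∈ B, y < b ∧ coeffs X B (X y) b ≠ 0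

/-- The `I`-internal bases contained in `A`. -/
def intBases (X : ι → Fin n → ℝ) (A I : Finset ι) : Set (Finset ι) :=
  {B | B ⊆ A ∧ IsColBasis X B ∧
    ∀ b ∈ B, b ∈ I → ¬ IsGreatest (↑(cocircuit X A B b) : Set ι) b}

/-- For `b ∈ B`, the hyperplane spanned by `B \ b` is bad for `B`, with last column `w`. -/
def IsBad (X : ι → Fin n → ℝ) (A I B : Finset ι) (w b : ι) : Prop :=
  w ∈ I ∧ IsGreatest (↑(cocircuit X A B b) : Set ι) w ∧
    ∀ y ∈ cocircuit X A B b, y ≠ b → y ∈ extSet X A B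

open Classical in
/-- The elements `b` of `B` for which the span of `B \ b` is bad with last column `w`. -/
def badSet (X : ι → Fin n → ℝ) (A I B : Finset ι) (w : ι) : Finset ι :=
  B.filter fun b => IsBad X A I B w b

/-- The column `w`, with its components along `badSet` removed. -/
def modCol (X : ι → Fin n → ℝ) (A I B : Finset ι) (w : ι) : Fin n → ℝ :=
  X w - ∑ b ∈ badSet X A I B w, coeffs X B (X w) b • X b

/-- The modified polynomial, relative to the columns in `A`. -/
def modPoly (X : ι → Fin n → ℝ) (A I B : Finset ι) : MvPolynomial (Fin n) ℂ :=
  ∏ z ∈ extSet X A B, linForm (modCol X A I B z)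

variable {X : ι → Fin n → ℝ} {A I B : Finset ι}

lemma mem_offSet {κ : Type*} {X : κ → Fin n → ℝ} {A : Finset κ} {η : Fin n → ℝ} {y : κ} :
    y ∈ offSet X A η ↔ y ∈ A ∧ η ⬝ᵥ X y ≠ 0 := by
  simp [offSet]

lemma mem_cocircuit {κ : Type*} {X : κ → Fin n → ℝ} {A B : Finset κ} {b y : κ} :
    y ∈ cocircuit X A B b ↔ y ∈ A ∧ coeffs X B (X y) b ≠ 0 := by
  simp [cocircuit]

lemma mem_extSet {y : ι} : y ∈ extSet X A B ↔
    y ∈ A ∧ y ∉ B ∧ ∃ b ∈ B, y < b ∧ coeffs X B (X y) b ≠ 0 := by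
  simp [extSet]

lemma mem_badSet {w b : ι} : b ∈ badSet X A I B w ↔ b ∈ B ∧ IsBad X A I B w b := by
  simp [badSet]

lemma notMem_of_mem_extSet {y : ι} (h : y ∈ extSet X A B) : y ∉ B := (mem_extSet.mp h).2.1

/-- The cocircuit of `b` has only one last column. The sets `badSet` are therefore disjoint, so
distinct factors are charged to distinct basis elements in the counting. -/
lemma badSet_eq_of_mem {w w' b : ι} (h : b ∈ badSet X A I B w) (h' : b ∈ badSet X A I B w') :
    w = w' :=
  (mem_badSet.mp h).2.2.1.unique (mem_badSet.mp h').2.2.1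

/-- Internality of `B` excludes `w = b`, the one column of the cocircuit that need not be external.
-/
lemma mem_extSet_of_mem_badSet (hB : B ∈ intBases X A I) {w b : ι}
    (h : b ∈ badSet X A I B w) : w ∈ extSet X A B := by
  obtain ⟨hb, hw, hg, he⟩ := mem_badSet.mp h
  refine he w (by exact_mod_cast hg.1) ?_
  rintro rfl
  exact hB.2.2 _ hb hw hg

lemma dotProduct_modCol (hB : IsColBasis X B) (η : Fin n → ℝ) (w : ι) :
    η ⬝ᵥ modCol X A I B w =
      ∑ b ∈ B with b ∉ badSet X A I B w, coeffs X B (X w) b * (η ⬝ᵥ X b) := by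
  have h1 : ∑ b ∈ badSet X A I B w, coeffs X B (X w) b * (η ⬝ᵥ X b) =
      ∑ b ∈ B with b ∈ badSet X A I B w, coeffs X B (X w) b * (η ⬝ᵥ X b) := by
    congr 1
    ext b
    simp only [Finset.mem_filter]
    exact ⟨fun h => ⟨(mem_badSet.mp h).1, h⟩, fun h => h.2⟩
  rw [modCol, dotProduct_sub, dotProduct_eq_sum_coeffs hB η (X w), dotProduct_sum]
  simp only [dotProduct_smul, smul_eq_mul]
  rw [h1, ← Finset.sum_filter_add_sum_filter_not B (fun b => b ∈ badSet X A I B w)]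
  ring

lemma coeffs_eq_zero_of_lt {w w' b : ι} (h : b ∈ badSet X A I B w) (hlt : w < w')
    (hw' : w' ∈ A) : coeffs X B (X w') b = 0 := by
  by_contra h0
  exact absurd ((mem_badSet.mp h).2.2.1.2 (by exact_mod_cast mem_cocircuit.mpr ⟨hw', h0⟩))
    (not_le.mpr hlt)

/-- The compensation step: if the columns off `η^⊥` are, outside of `extSet`, just one `b̃ ∈ B` and
elements of `badSet`s, then the last column of the cocircuit of `b̃` leaves the complement of `η^⊥`
when it is modified. -/
lemma exists_compensation (hB : B ∈ intBases X A I) (hlast : ∀ x ∈ A, x ∉ I → ∀ y ∈ I, x < y)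
    {η : Fin n → ℝ} {V : Finset ι} {β : ι → ι} {bt u : ι}
    (hV : ∀ v ∈ V, β v ∈ badSet X A I B v) (hbtB : bt ∈ B) (hbtη : η ⬝ᵥ X bt ≠ 0)
    (hbt : ∀ v ∈ V, bt ∉ badSet X A I B v) (hu : u ∈ I) (huA : u ∈ A)
    (hub : coeffs X B (X u) bt ≠ 0) (huV : ∀ v ∈ V, v ≤ u)
    (hoff : ∀ y ∈ A, y ∉ extSet X A B → η ⬝ᵥ X y ≠ 0 → y = bt ∨ ∃ v ∈ V, y = β v) :
    ∃ z ∈ extSet X A B, η ⬝ᵥ X z ≠ 0 ∧ η ⬝ᵥ modCol X A I B z = 0 := by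
  have hbas := hB.2.1
  have hBoff : ∀ b ∈ B, η ⬝ᵥ X b ≠ 0 → b = bt ∨ ∃ v ∈ V, b = β v := fun b hb =>
    hoff b (hB.1 hb) fun h => notMem_of_mem_extSet h hb
  have hβt : ∀ v ∈ V, β v ≠ bt := fun v hv h => hbt v hv (h ▸ hV v hv)
  have hself : ∀ v ∈ V, coeffs X B (X (β v)) bt = 0 := fun v hv => by
    rw [coeffs_self hbas (mem_badSet.mp (hV v hv)).1, Pi.single_eq_of_ne (hβt v hv).symm]
  have hne : (cocircuit X A B bt).Nonempty := ⟨u, mem_cocircuit.mpr ⟨huA, hub⟩⟩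
  obtain ⟨vt, hvt⟩ : ∃ vt, IsGreatest (↑(cocircuit X A B bt) : Set ι) vt :=
    ⟨_, (cocircuit X A B bt).isGreatest_max' hne⟩
  obtain ⟨hvtA, hvtc⟩ := mem_cocircuit.mp (by exact_mod_cast hvt.1 : vt ∈ cocircuit X A B bt)
  have huvt : u ≤ vt := hvt.2 (by exact_mod_cast mem_cocircuit.mpr ⟨huA, hub⟩)
  have hvtI : vt ∈ I := by
    by_contra h
    exact absurd (hlast vt hvtA h u hu) (not_lt.mpr huvt)
  -- If `y` lies on `η^⊥`, its nonzero component along `bt` must be cancelled by one along some `β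
  -- v`; so `y` is in the cocircuit of `β v`, and badness of `β v` makes `y` external.
  have hext : ∀ y ∈ cocircuit X A B bt, y ≠ bt → y ∈ extSet X A B := by
    intro y hy hyb
    obtain ⟨hyA, hyc⟩ := mem_cocircuit.mp hy
    by_contra hye
    by_cases hη : η ⬝ᵥ X y = 0
    · obtain ⟨v, hv, hvc⟩ : ∃ v ∈ V, coeffs X B (X y) (β v) ≠ 0 := by
        by_contra! hall
        rw [dotProduct_eq_sum_coeffs hbas, Finset.sum_eq_single bt] at hη
        · exact mul_ne_zero hyc hbtη hη
        · intro b hb hbne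
          by_cases hηb : η ⬝ᵥ X b = 0
          · rw [hηb, mul_zero]
          · obtain rfl | ⟨v, hv, rfl⟩ := hBoff b hb hηb
            · exact (hbne rfl).elim
            · rw [hall v hv, zero_mul]
        · exact fun h => (h hbtB).elim
      by_cases hyv : y = β v
      · subst hyv
        exact hyc (hself v hv)
      · exact hye ((mem_badSet.mp (hV v hv)).2.2.2 y (mem_cocircuit.mpr ⟨hyA, hvc⟩) hyv)
    · obtain rfl | ⟨v, hv, rfl⟩ := hoff y hyA hye hη
      · exact hyb rfl
      · exact hyc (hself v hv)
  have hbad : bt ∈ badSet X A I B vt := mem_badSet.mpr ⟨hbtB, hvtI, hvt, hext⟩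
  -- Hence `bt` is the only basis element off `η^⊥` that occurs in `vt`, and modifying `vt` removes
  -- exactly this component.
  have hzero : ∀ v ∈ V, coeffs X B (X vt) (β v) = 0 := fun v hv =>
    coeffs_eq_zero_of_lt (hV v hv) (lt_of_le_of_ne ((huV v hv).trans huvt)
      (by rintro rfl; exact hbt _ hv hbad)) hvtA
  refine ⟨vt, mem_extSet_of_mem_badSet hB hbad, ?_, ?_⟩
  · rw [dotProduct_eq_sum_coeffs hbas, Finset.sum_eq_single bt]
    · exact mul_ne_zero hvtc hbtη
    · intro b hb hbne
      by_cases hηb : η ⬝ᵥ X b = 0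
      · rw [hηb, mul_zero]
      · obtain rfl | ⟨v, hv, rfl⟩ := hBoff b hb hηb
        · exact (hbne rfl).elim
        · rw [hzero v hv, zero_mul]
    · exact fun h => (h hbtB).elim
  · rw [dotProduct_modCol hbas]
    refine Finset.sum_eq_zero fun b hb => ?_
    obtain ⟨hbB, hbb⟩ := Finset.mem_filter.mp hb
    by_cases hηb : η ⬝ᵥ X b = 0
    · rw [hηb, mul_zero]
    · obtain rfl | ⟨v, hv, rfl⟩ := hBoff b hbB hηb
      · exact (hbb hbad).elim
      · rw [hzero v hv, zero_mul]

/-- `N` and `M` are the external columns off `η^⊥` after and before modification, and `R` the other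
columns off `η^⊥`. Thus `#N = #M + #V - #C`, where `V` is moved off `η^⊥` and `C` onto it. An
injection `β : V → R` missing some `bt ∈ R` gives the first inequality. If the second one failed,
`R` would be just `β(V) ∪ {bt}` and `C` empty, which `exists_compensation` contradicts. -/
lemma card_filter_modCol_lt (hB : B ∈ intBases X A I)
    (hlast : ∀ x ∈ A, x ∉ I → ∀ y ∈ I, x < y) {η : Fin n → ℝ} (hη : η ≠ 0) :
    ((extSet X A B).filter fun z => η ⬝ᵥ modCol X A I B z ≠ 0).card < (offSet X A η).card ∧
    ((∃ w ∈ I, IsGreatest (↑(offSet X A η) : Set ι) w) →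
      ((extSet X A B).filter fun z => η ⬝ᵥ modCol X A I B z ≠ 0).card + 1 <
        (offSet X A η).card) := by
  have hbas := hB.2.1
  set E := extSet X A B with hE
  set N := E.filter fun z => η ⬝ᵥ modCol X A I B z ≠ 0 with hN
  set M := E.filter fun z => η ⬝ᵥ X z ≠ 0 with hM
  set R := (offSet X A η).filter fun z => z ∉ E with hR
  have hoff : M.card + R.card = (offSet X A η).card := by
    rw [← Finset.card_filter_add_card_filter_not (s := offSet X A η) (fun z => z ∈ E)]
    congr 2
    ext z
    simp only [hM, Finset.mem_filter, mem_offSet]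
    exact ⟨fun h => ⟨⟨(mem_extSet.mp h.1).1, h.2⟩, h.1⟩, fun h => ⟨h.2, h.1.2⟩⟩
  set V := N \ M with hV
  set C := M \ N with hC
  have hNM : N.card + C.card = M.card + V.card := by
    have h1 : V.card + (N ∩ M).card = N.card := Finset.card_sdiff_add_card_inter N M
    have h2 : C.card + (M ∩ N).card = M.card := Finset.card_sdiff_add_card_inter M N
    rw [Finset.inter_comm] at h2
    omega
  have hVmem : ∀ v ∈ V, v ∈ E ∧ η ⬝ᵥ X v = 0 ∧ η ⬝ᵥ modCol X A I B v ≠ 0 := by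
    intro v hv
    simp only [hV, hN, hM, Finset.mem_sdiff, Finset.mem_filter, not_and, not_not] at hv
    exact ⟨hv.1.1, hv.2 hv.1.1, hv.1.2⟩
  have hβ : ∀ v ∈ V, ∃ b ∈ badSet X A I B v, η ⬝ᵥ X b ≠ 0 := by
    intro v hv
    obtain ⟨-, h1, h2⟩ := hVmem v hv
    by_contra! h
    apply h2
    rw [modCol, dotProduct_sub, h1, dotProduct_sum, Finset.sum_eq_zero, sub_zero]
    intro b hb
    rw [dotProduct_smul, h b hb, smul_zero]
  choose! β hβbad hβη using hβ
  have hβinj : Set.InjOn β V := fun v hv w hw h =>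
    badSet_eq_of_mem (hβbad v hv) (h ▸ hβbad w hw)
  have hBR : ∀ b ∈ B, η ⬝ᵥ X b ≠ 0 → b ∈ R := fun b hb h =>
    Finset.mem_filter.mpr ⟨mem_offSet.mpr ⟨hB.1 hb, h⟩, fun h' => notMem_of_mem_extSet h' hb⟩
  have hβR : V.image β ⊆ R := by
    intro b hb
    obtain ⟨v, hv, rfl⟩ := Finset.mem_image.mp hb
    exact hBR _ (mem_badSet.mp (hβbad v hv)).1 (hβη v hv)
  have hcardβ : (V.image β).card = V.card := Finset.card_image_of_injOn hβinj
  obtain ⟨bt, hbtB, hbtη, hbt, hbtV⟩ : ∃ bt ∈ B, η ⬝ᵥ X bt ≠ 0 ∧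
      (∀ v ∈ V, bt ∉ badSet X A I B v) ∧ (V.Nonempty → ∃ u ∈ I, u ∈ A ∧
        coeffs X B (X u) bt ≠ 0 ∧ ∀ v ∈ V, v ≤ u) := by
    by_cases hVne : V.Nonempty
    -- `bt` is a component of `k'` off `η^⊥`, for the last `k ∈ V`. It is not in `badSet` of `k`,
    -- which was removed, nor of an earlier `v`, because `v` is the last column with a component
    -- along the elements of its `badSet`.
    · set k := V.max' hVne
      have hk : k ∈ V := V.max'_mem hVne
      obtain ⟨hkE, -, hk2⟩ := hVmem k hk
      rw [dotProduct_modCol hbas] at hk2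
      obtain ⟨bt, hbt, hne⟩ := Finset.exists_ne_zero_of_sum_ne_zero hk2
      obtain ⟨hbtB, hbtk⟩ := Finset.mem_filter.mp hbt
      have hkA := (mem_extSet.mp hkE).1
      refine ⟨bt, hbtB, right_ne_zero_of_mul hne, ?_, fun _ => ⟨k,
        (mem_badSet.mp (hβbad k hk)).2.1, hkA, left_ne_zero_of_mul hne, fun v hv =>
          V.le_max' v hv⟩⟩
      intro v hv hvb
      obtain h | h := (V.le_max' v hv).lt_or_eq
      · exact left_ne_zero_of_mul hne (coeffs_eq_zero_of_lt hvb h hkA)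
      · exact hbtk (by rwa [h] at hvb)
    · obtain ⟨b, hb, hbη⟩ := exists_dotProduct_ne_zero_of_isColBasis hbas hη
      rw [Finset.not_nonempty_iff_eq_empty] at hVne
      exact ⟨b, hb, hbη, by simp [hVne], fun h => (h.ne_empty hVne).elim⟩
  have hbtβ : bt ∉ V.image β := by
    intro h
    obtain ⟨v, hv, rfl⟩ := Finset.mem_image.mp h
    exact hbt v hv (hβbad v hv)
  have hsub : insert bt (V.image β) ⊆ R := Finset.insert_subset (hBR bt hbtB hbtη) hβR
  have hcard : V.card + 1 ≤ R.card := by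
    rw [← hcardβ, ← Finset.card_insert_of_notMem hbtβ]
    exact Finset.card_le_card hsub
  refine ⟨by omega, ?_⟩
  rintro ⟨u, huI, hu⟩
  by_contra hcon
  have hReq : insert bt (V.image β) = R := by
    refine Finset.eq_of_subset_of_card_le hsub ?_
    rw [Finset.card_insert_of_notMem hbtβ, hcardβ]
    omega
  have hCe : C = ∅ := Finset.card_eq_zero.mp (by omega)
  have hRmem : ∀ y ∈ A, y ∉ E → η ⬝ᵥ X y ≠ 0 → y = bt ∨ ∃ v ∈ V, y = β v := by
    intro y hyA hyE hyη
    have : y ∈ R := Finset.mem_filter.mpr ⟨mem_offSet.mpr ⟨hyA, hyη⟩, hyE⟩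
    rw [← hReq, Finset.mem_insert, Finset.mem_image] at this
    exact this.imp_right fun ⟨v, hv, h⟩ => ⟨v, hv, h.symm⟩
  obtain ⟨u', hu'I, hu'A, hu'c, hu'V⟩ : ∃ u ∈ I, u ∈ A ∧
        coeffs X B (X u) bt ≠ 0 ∧ ∀ v ∈ V, v ≤ u := by
    by_cases hVne : V.Nonempty
    · exact hbtV hVne
    · rw [Finset.not_nonempty_iff_eq_empty] at hVne
      obtain ⟨huA, huη⟩ := mem_offSet.mp (by exact_mod_cast hu.1 : u ∈ offSet X A η)
      refine ⟨u, huI, huA, fun h0 => huη ?_, by simp [hVne]⟩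
      rw [dotProduct_eq_sum_coeffs hbas]
      refine Finset.sum_eq_zero fun b hb => ?_
      by_cases hbη : η ⬝ᵥ X b = 0
      · rw [hbη, mul_zero]
      · obtain rfl | ⟨v, hv, -⟩ := hRmem b (hB.1 hb) (fun h => notMem_of_mem_extSet h hb) hbη
        · rw [h0, zero_mul]
        · simp [hVne] at hv
  obtain ⟨z, hzE, hz1, hz2⟩ := exists_compensation hB hlast hβbad hbtB hbtη hbt hu'I hu'A hu'c
    hu'V hRmem
  have : z ∈ C := by
    simp only [hC, hN, hM, Finset.mem_sdiff, Finset.mem_filter, not_and, not_not]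
    exact ⟨⟨hzE, hz1⟩, fun _ => hz2⟩
  simp [hCe] at this

lemma modPoly_mem_kerSpace (hlast : ∀ x ∈ A, x ∉ I → ∀ y ∈ I, x < y)
    (hB : B ∈ intBases X A I) : modPoly X A I B ∈ kerSpace X A I := by
  intro η hη
  obtain ⟨h1, h2⟩ := card_filter_modCol_lt hB hlast hη
  exact ⟨dirEnd_pow_prod_eq_zero η _ _ h1, fun h =>
    dirEnd_pow_prod_eq_zero η _ _ (by have := h2 h; omega)⟩

end Relative

/-- Glues independence along deletion (the part killed by `ρ`) and contraction (the part seen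
through `ρ`). -/
lemma linearIndepOn_union_of_map {K M N α : Type*} [Field K] [AddCommGroup M] [Module K M]
    [AddCommGroup N] [Module K N] {f : α → M} {S T : Set α} (ρ : M →ₗ[K] N)
    (hS : LinearIndepOn K f S) (hT : LinearIndepOn K (ρ ∘ f) T) (h0 : ∀ x ∈ S, ρ (f x) = 0) :
    LinearIndepOn K f (S ∪ T) := by
  classical
  rw [linearIndepOn_iff'] at hS hT ⊢
  intro t g ht hsum
  have hout : ∀ i ∈ t, i ∉ T → i ∈ S := fun i hi hiT => (ht hi).resolve_right hiT
  have h1 : ∀ i ∈ t.filter (· ∈ T), g i = 0 := by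
    refine hT _ g (fun i hi => (Finset.mem_filter.mp hi).2) ?_
    have := congrArg ρ hsum
    rw [map_sum, map_zero] at this
    rw [Finset.sum_filter]
    refine (Finset.sum_congr rfl fun i hi => ?_).trans this
    split_ifs with h
    · simp
    · rw [map_smul, h0 i (hout i hi h), smul_zero]
  have h2 : ∀ i ∈ t.filter (· ∉ T), g i = 0 := by
    refine hS _ g (fun i hi => ?_) ?_
    · rw [Finset.mem_coe, Finset.mem_filter] at hi
      exact hout i hi.1 hi.2
    · rw [Finset.sum_filter]
      refine (Finset.sum_congr rfl fun i hi => ?_).trans hsum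
      split_ifs with h
      · rw [h1 i (Finset.mem_filter.mpr ⟨hi, h⟩), zero_smul]
      · rfl
  intro i hi
  by_cases h : i ∈ T
  · exact h1 i (Finset.mem_filter.mpr ⟨hi, h⟩)
  · exact h2 i (Finset.mem_filter.mpr ⟨hi, h⟩)

/-! ### Induction on the set of columns, by removing the first one. -/

section Induction

variable {n : ℕ} {ι : Type*} [LinearOrder ι] {X : ι → Fin n → ℝ} {I B s : Finset ι} {a : ι}

/-! ### Bases that avoid the first column. -/

section Deletion

lemma isGreatest_cocircuit_insert_iff (ha : ∀ x ∈ s, a < x) {b w : ι} (hw : w ∈ s) :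
    IsGreatest (↑(cocircuit X (insert a s) B b) : Set ι) w ↔
      IsGreatest (↑(cocircuit X s B b) : Set ι) w := by
  simp only [IsGreatest, Finset.mem_coe, mem_cocircuit, mem_upperBounds, Finset.mem_insert]
  constructor
  · exact fun h => ⟨⟨hw, h.1.2⟩, fun x hx => h.2 x ⟨Or.inr hx.1, hx.2⟩⟩
  · refine fun h => ⟨⟨Or.inr hw, h.1.2⟩, ?_⟩
    rintro x ⟨rfl | hx, hx'⟩
    · exact (ha w hw).le
    · exact h.2 x ⟨hx, hx'⟩

lemma exists_coeffs_ne_zero (hB : IsColBasis X B) (ha : X a ≠ 0) :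
    ∃ b ∈ B, coeffs X B (X a) b ≠ 0 := by
  by_contra! h
  apply ha
  rw [← sum_coeffs hB (X a)]
  exact Finset.sum_eq_zero fun b hb => by rw [h b hb, zero_smul]

lemma mem_extSet_insert_of_mem {y : ι} (hy : y ∈ s) :
    y ∈ extSet X (insert a s) B ↔ y ∈ extSet X s B := by
  simp [mem_extSet, hy]

lemma extSet_insert (ha : ∀ x ∈ s, a < x) (hB : IsColBasis X B) (hBs : B ⊆ s) (hXa : X a ≠ 0) :
    extSet X (insert a s) B = insert a (extSet X s B) := by
  have has : a ∉ s := fun h => lt_irrefl a (ha a h)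
  obtain ⟨b, hb, hc⟩ := exists_coeffs_ne_zero hB hXa
  ext y
  rw [Finset.mem_insert]
  by_cases hy : y = a
  · subst hy
    simpa [mem_extSet] using ⟨fun h => has (hBs h), b, hb, ha b (hBs hb), hc⟩
  · simp [mem_extSet, hy]

/-- When `a` enters the cocircuit of `b`, it precedes `b` and so is external; it is never last
there, as `b` is in the cocircuit too. -/
lemma isBad_insert_iff (ha : ∀ x ∈ s, a < x) (hBs : B ⊆ s) (hB : IsColBasis X B)
    {b w : ι} (hb : b ∈ B) : IsBad X (insert a s) I B w b ↔ IsBad X s I B w b := by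
  have has : a ∉ s := fun h => lt_irrefl a (ha a h)
  have hbb : coeffs X B (X b) b ≠ 0 := by simp [coeffs_self hB hb]
  have key : (∀ y ∈ cocircuit X (insert a s) B b, y ≠ b → y ∈ extSet X (insert a s) B) ↔
      ∀ y ∈ cocircuit X s B b, y ≠ b → y ∈ extSet X s B := by
    simp only [mem_cocircuit, Finset.mem_insert]
    constructor
    · exact fun h y hy hyb => (mem_extSet_insert_of_mem hy.1).mp (h y ⟨Or.inr hy.1, hy.2⟩ hyb)
    · rintro h y ⟨rfl | hy, hyc⟩ hyb
      · exact mem_extSet.mpr ⟨Finset.mem_insert_self _ _, fun h => has (hBs h), b, hb,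
          ha b (hBs hb), hyc⟩
      · exact (mem_extSet_insert_of_mem hy).mpr (h y ⟨hy, hyc⟩ hyb)
  rw [IsBad, IsBad, key]
  refine and_congr_right fun _ => and_congr_left fun _ => ?_
  constructor
  · intro h
    refine (isGreatest_cocircuit_insert_iff ha ?_).mp h
    refine (Finset.mem_insert.mp (mem_cocircuit.mp (by exact_mod_cast h.1)).1).resolve_left ?_
    rintro rfl
    have : b ≤ w := h.2 (by
      exact_mod_cast mem_cocircuit.mpr ⟨Finset.mem_insert_of_mem (hBs hb), hbb⟩)
    exact absurd (ha b (hBs hb)) (not_lt.mpr this)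
  · intro h
    exact (isGreatest_cocircuit_insert_iff ha
      (mem_cocircuit.mp (by exact_mod_cast h.1 : w ∈ cocircuit X s B b)).1).mpr h

lemma badSet_insert (ha : ∀ x ∈ s, a < x) (hBs : B ⊆ s) (hB : IsColBasis X B) (w : ι) :
    badSet X (insert a s) I B w = badSet X s I B w := by
  ext b
  rw [mem_badSet, mem_badSet]
  exact and_congr_right fun hb => isBad_insert_iff ha hBs hB hb

lemma badSet_eq_empty (ha : a ∉ s) : badSet X s I B a = ∅ := by
  refine Finset.eq_empty_of_forall_notMem fun b hb => ha ?_
  exact (mem_cocircuit.mp (by exact_mod_cast (mem_badSet.mp hb).2.2.1.1)).1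

lemma modPoly_insert (ha : ∀ x ∈ s, a < x) (hBs : B ⊆ s) (hB : IsColBasis X B) (hXa : X a ≠ 0) :
    modPoly X (insert a s) I B = linForm (X a) * modPoly X s I B := by
  have has : a ∉ s := fun h => lt_irrefl a (ha a h)
  rw [modPoly, extSet_insert ha hB hBs hXa,
    Finset.prod_insert fun h => has (mem_extSet.mp h).1]
  congr 1
  · rw [modCol, badSet_insert ha hBs hB, badSet_eq_empty has, Finset.sum_empty, sub_zero]
  · exact Finset.prod_congr rfl fun z _ => by rw [modCol, badSet_insert ha hBs hB, modCol]

lemma mem_intBases_insert_iff (ha : ∀ x ∈ s, a < x) (haB : a ∉ B) :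
    B ∈ intBases X (insert a s) I ↔ B ∈ intBases X s I := by
  have h1 : B ⊆ insert a s ↔ B ⊆ s := by
    rw [← Finset.erase_eq_of_notMem haB, Finset.subset_insert_iff, Finset.erase_idem]
  simp only [intBases, Set.mem_ofPred_eq, h1]
  refine and_congr_right fun hBs => and_congr_right fun _ => forall₂_congr fun b hb => ?_
  rw [isGreatest_cocircuit_insert_iff ha (hBs hb)]

lemma offSet_insert_of_eq_zero {η : Fin n → ℝ} (h : η ⬝ᵥ X a = 0) :
    offSet X (insert a s) η = offSet X s η := by
  rw [offSet, Finset.filter_insert, if_neg (not_not.mpr h), offSet]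

lemma offSet_insert_of_ne_zero {η : Fin n → ℝ} (h : η ⬝ᵥ X a ≠ 0) :
    offSet X (insert a s) η = insert a (offSet X s η) := by
  rw [offSet, Finset.filter_insert, if_pos h, offSet]

/-- If `a` is off `η^⊥`, removing it lowers the number of columns off `η^⊥` by one, and cancelling
`p_a` lowers the annihilating exponent by one as well. -/
lemma mem_kerSpace_of_linForm_mul (ha : ∀ x ∈ s, a < x) (hXa : X a ≠ 0)
    {q : MvPolynomial (Fin n) ℂ} (hq : linForm (X a) * q ∈ kerSpace X (insert a s) I) :
    q ∈ kerSpace X s I := by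
  have has : a ∉ s := fun h => lt_irrefl a (ha a h)
  intro η hη
  obtain ⟨h1, h2⟩ := hq η hη
  by_cases hηa : η ⬝ᵥ X a = 0
  · rw [offSet_insert_of_eq_zero hηa] at h1 h2
    simp only [dirEnd_pow_linForm_mul_of_dotProduct_eq_zero hηa, mul_eq_zero,
      linForm_ne_zero hXa, false_or] at h1 h2
    exact ⟨h1, h2⟩
  · rw [offSet_insert_of_ne_zero hηa,
      Finset.card_insert_of_notMem fun h => has (mem_offSet.mp h).1] at h1 h2
    refine ⟨dirEnd_pow_eq_zero_of_linForm_mul hηa h1, ?_⟩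
    rintro ⟨w, hwI, hw⟩
    have hws : w ∈ offSet X s η := by exact_mod_cast hw.1
    -- Positivity keeps the truncated subtraction in the exponent honest.
    have hpos : 0 < (offSet X s η).card := Finset.card_pos.mpr ⟨w, hws⟩
    refine dirEnd_pow_eq_zero_of_linForm_mul hηa ?_
    rw [Nat.sub_add_cancel hpos]
    refine h2 ⟨w, hwI, ?_⟩
    rw [Finset.coe_insert]
    have := hw.insert a
    rwa [max_eq_right (ha w (mem_offSet.mp hws).1).le] at this

end Deletion

/-! ### A first column that is zero, as may arise from contraction, changes nothing. -/

section Loop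

lemma coeffs_zero (hB : IsColBasis X B) (b : ι) : coeffs X B 0 b = 0 := by
  rw [coeffs_eq hB (c := 0) (by simp) (by simp)]
  rfl

lemma cocircuit_insert_of_eq_zero (hB : IsColBasis X B) (hXa : X a = 0) (b : ι) :
    cocircuit X (insert a s) B b = cocircuit X s B b := by
  rw [cocircuit, Finset.filter_insert, if_neg (by simp [hXa, coeffs_zero hB]), cocircuit]

lemma extSet_insert_of_eq_zero (hB : IsColBasis X B) (hXa : X a = 0) :
    extSet X (insert a s) B = extSet X s B := by
  rw [extSet, Finset.filter_insert, if_neg (by simp [hXa, coeffs_zero hB]), extSet]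

lemma modPoly_insert_of_eq_zero (hB : IsColBasis X B) (hXa : X a = 0) :
    modPoly X (insert a s) I B = modPoly X s I B := by
  have h : ∀ w, badSet X (insert a s) I B w = badSet X s I B w := fun w => by
    ext b
    simp only [mem_badSet, IsBad, cocircuit_insert_of_eq_zero hB hXa,
      extSet_insert_of_eq_zero hB hXa]
  simp only [modPoly, modCol, h, extSet_insert_of_eq_zero hB hXa]

lemma intBases_insert_of_eq_zero (hXa : X a = 0) :
    intBases X (insert a s) I = intBases X s I := by
  ext B
  have h : IsColBasis X B → (B ⊆ insert a s ↔ B ⊆ s) := by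
    intro hB
    have haB : a ∉ B := fun h => hB.1.ne_zero h hXa
    rw [← Finset.erase_eq_of_notMem haB, Finset.subset_insert_iff, Finset.erase_idem]
  simp only [intBases, Set.mem_ofPred_eq]
  constructor
  · rintro ⟨h1, h2, h3⟩
    exact ⟨(h h2).mp h1, h2, by simpa only [cocircuit_insert_of_eq_zero h2 hXa] using h3⟩
  · rintro ⟨h1, h2, h3⟩
    exact ⟨(h h2).mpr h1, h2, by simpa only [cocircuit_insert_of_eq_zero h2 hXa] using h3⟩

lemma kerSpace_insert_of_eq_zero (hXa : X a = 0) :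
    kerSpace X (insert a s) I = kerSpace X s I := by
  have h : ∀ η : Fin n → ℝ, offSet X (insert a s) η = offSet X s η := fun η =>
    offSet_insert_of_eq_zero (by simp [hXa])
  ext p
  change (∀ η : Fin n → ℝ, _) ↔ ∀ η : Fin n → ℝ, _
  simp only [h]

end Loop

/-! ### Bases that contain the first column. -/

section Contraction

variable {m : ℕ} {π : (Fin n → ℝ) →ₗ[ℝ] (Fin m → ℝ)}

lemma map_eq_zero_of_ker_eq {v : Fin n → ℝ} (hπ : LinearMap.ker π = Submodule.span ℝ {v}) :
    π v = 0 := by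
  rw [← LinearMap.mem_ker, hπ]
  exact Submodule.mem_span_singleton_self _

lemma formMap_mem_kerSpace (hs : Function.Surjective π)
    (hπ : LinearMap.ker π = Submodule.span ℝ {X a}) {p : MvPolynomial (Fin n) ℂ}
    (hp : p ∈ kerSpace X (insert a s) I) :
    formMap π p ∈ kerSpace (fun x => π (X x)) s I := by
  intro θ hθ
  obtain ⟨η, hη⟩ := exists_dotProduct_eq
    ({ toFun := fun v => θ ⬝ᵥ π v
       map_add' := fun v w => by simp
       map_smul' := fun c v => by simp } : (Fin n → ℝ) →ₗ[ℝ] ℝ)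
  replace hη : ∀ v, η ⬝ᵥ v = θ ⬝ᵥ π v := hη
  have hη0 : η ≠ 0 := by
    rintro rfl
    obtain ⟨v, hv⟩ := hs θ
    have := hη v
    rw [hv, zero_dotProduct] at this
    exact hθ (dotProduct_self_eq_zero.mp this.symm)
  have hoff : offSet X (insert a s) η = offSet (fun x => π (X x)) s θ := by
    rw [offSet_insert_of_eq_zero (by rw [hη, map_eq_zero_of_ker_eq hπ, dotProduct_zero])]
    simp only [offSet, hη]
  have h := hp η hη0
  rw [hoff] at h
  refine ⟨?_, fun hw => ?_⟩
  · rw [← formMap_dirEnd_pow π hη, h.1, map_zero]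
  · rw [← formMap_dirEnd_pow π hη, h.2 hw, map_zero]

lemma cocircuit_erase (hs : Function.Surjective π)
    (hπ : LinearMap.ker π = Submodule.span ℝ {X a}) (haB : a ∈ B)
    (hB : IsColBasis X B) {b : ι} (hb : b ≠ a) :
    cocircuit (fun x => π (X x)) s (B.erase a) b = cocircuit X (insert a s) B b := by
  rw [cocircuit, cocircuit, Finset.filter_insert, if_neg]
  · simp only [coeffs_erase hs hπ haB hB _ hb]
  · simp [coeffs_self hB haB, Pi.single_eq_of_ne hb]

lemma extSet_erase (ha : ∀ x ∈ s, a < x) (hs : Function.Surjective π)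
    (hπ : LinearMap.ker π = Submodule.span ℝ {X a}) (haB : a ∈ B)
    (hB : IsColBasis X B) :
    extSet (fun x => π (X x)) s (B.erase a) = extSet X (insert a s) B := by
  have has : a ∉ s := fun h => lt_irrefl a (ha a h)
  ext y
  simp only [mem_extSet, Finset.mem_insert, Finset.mem_erase]
  constructor
  · rintro ⟨hy, hyB, b, ⟨hba, hb⟩, hlt, hc⟩
    rw [coeffs_erase hs hπ haB hB _ hba] at hc
    exact ⟨Or.inr hy, fun h => hyB ⟨(ha y hy).ne', h⟩, b, hb, hlt, hc⟩
  · rintro ⟨rfl | hy, hyB, b, hb, hlt, hc⟩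
    · exact (hyB haB).elim
    · have hba : b ≠ a := ((ha y hy).trans hlt).ne'
      exact ⟨hy, fun h => hyB h.2, b, ⟨hba, hb⟩, hlt, by rwa [coeffs_erase hs hπ haB hB _ hba]⟩

/-- The possible loss of `a` from `badSet` is harmless for `map_modCol`, since `π` kills `X a`. -/
lemma badSet_erase (ha : ∀ x ∈ s, a < x) (hs : Function.Surjective π)
    (hπ : LinearMap.ker π = Submodule.span ℝ {X a}) (haB : a ∈ B)
    (hB : IsColBasis X B) (w : ι) :
    badSet (fun x => π (X x)) s I (B.erase a) w = (badSet X (insert a s) I B w).erase a := by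
  ext b
  simp only [mem_badSet, Finset.mem_erase, and_assoc]
  refine and_congr_right fun hba => and_congr_right fun _ => ?_
  rw [IsBad, IsBad, cocircuit_erase hs hπ haB hB hba, extSet_erase ha hs hπ haB hB]

lemma map_modCol (ha : ∀ x ∈ s, a < x) (hs : Function.Surjective π)
    (hπ : LinearMap.ker π = Submodule.span ℝ {X a}) (haB : a ∈ B)
    (hB : IsColBasis X B) (w : ι) :
    π (modCol X (insert a s) I B w) = modCol (fun x => π (X x)) s I (B.erase a) w := by
  rw [modCol, modCol, badSet_erase ha hs hπ haB hB, map_sub, map_sum]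
  congr 1
  rw [← Finset.sum_erase (a := a) (badSet X (insert a s) I B w)
    (by rw [map_smul, map_eq_zero_of_ker_eq hπ, smul_zero])]
  exact Finset.sum_congr rfl fun b hb => by
    rw [map_smul, coeffs_erase hs hπ haB hB _ (Finset.ne_of_mem_erase hb)]

lemma formMap_modPoly (ha : ∀ x ∈ s, a < x) (hs : Function.Surjective π)
    (hπ : LinearMap.ker π = Submodule.span ℝ {X a}) (haB : a ∈ B)
    (hB : IsColBasis X B) :
    formMap π (modPoly X (insert a s) I B) = modPoly (fun x => π (X x)) s I (B.erase a) := by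
  rw [modPoly, modPoly, map_prod, extSet_erase ha hs hπ haB hB]
  exact Finset.prod_congr rfl fun z _ => by rw [formMap_linForm, map_modCol ha hs hπ haB hB]

lemma mem_intBases_erase_iff (hs : Function.Surjective π)
    (hπ : LinearMap.ker π = Submodule.span ℝ {X a}) (haB : a ∈ B)
    (hB : IsColBasis X B) :
    B ∈ intBases X (insert a s) I ↔ B.erase a ∈ intBases (fun x => π (X x)) s I ∧
      (a ∈ I → ¬ IsGreatest (↑(cocircuit X (insert a s) B a) : Set ι) a) := by
  simp only [intBases, Set.mem_ofPred_eq, hB, isColBasis_erase hs hπ haB hB, true_and,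
    Finset.subset_insert_iff, and_assoc]
  refine and_congr_right fun _ => ?_
  constructor
  · intro h
    refine ⟨fun b hb hbI => ?_, h a haB⟩
    rw [cocircuit_erase hs hπ haB hB (Finset.ne_of_mem_erase hb)]
    exact h b (Finset.mem_of_mem_erase hb) hbI
  · rintro ⟨h1, h2⟩ b hb hbI
    by_cases hba : b = a
    · subst hba
      exact h2 hbI
    · rw [← cocircuit_erase hs hπ haB hB hba]
      exact h1 b (Finset.mem_erase.mpr ⟨hba, hb⟩) hbI

/-- As the first column, `a` can be last off a hyperplane only if it is alone there; the exponent `m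
- 1` is then `0`. -/
lemma eq_zero_of_isGreatest_cocircuit (ha : ∀ x ∈ s, a < x) (hB : IsColBasis X B) (haB : a ∈ B)
    (haI : a ∈ I) (hg : IsGreatest (↑(cocircuit X (insert a s) B a) : Set ι) a)
    {p : MvPolynomial (Fin n) ℂ} (hp : p ∈ kerSpace X (insert a s) I) : p = 0 := by
  obtain ⟨η, hη⟩ := exists_dotProduct_eq_coeffs hB a
  have hη0 : η ≠ 0 := by
    rintro rfl
    have := hη (X a)
    simp [coeffs_self hB haB] at this
  have hoff : offSet X (insert a s) η = cocircuit X (insert a s) B a := by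
    simp only [offSet, cocircuit, hη]
  have hsing : offSet X (insert a s) η = {a} := by
    rw [hoff]
    refine Finset.eq_singleton_iff_unique_mem.mpr ⟨by exact_mod_cast hg.1, fun y hy => ?_⟩
    refine (Finset.mem_insert.mp (mem_cocircuit.mp hy).1).resolve_right fun h => ?_
    exact absurd (ha y h) (not_lt.mpr (hg.2 (by exact_mod_cast hy)))
  have h := (hp η hη0).2 ⟨a, haI, by rw [hoff]; exact hg⟩
  simpa [hsing] using h

end Contraction

/-- The modified polynomials of the internal bases in `A` are linearly independent and span
`kerSpace`. -/
theorem linearIndepOn_modPoly_and_kerSpace_le_span (A I : Finset ι)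
    (hlast : ∀ x ∈ A, x ∉ I → ∀ y ∈ I, x < y) : ∀ {n : ℕ} (X : ι → Fin n → ℝ),
    LinearIndepOn ℂ (modPoly X A I) (intBases X A I) ∧
      kerSpace X A I ≤ Submodule.span ℂ (modPoly X A I '' intBases X A I) := by
  induction A using Finset.induction_on_min with
  | empty =>
    intro n X
    cases n with
    | zero =>
      have hb : intBases X ∅ I = {∅} := by
        ext B
        simp only [intBases, Finset.subset_empty, Set.mem_ofPred_eq, Set.mem_singleton_iff]
        constructor
        · exact fun h => h.1
        · rintro rfl
          refine ⟨rfl, isColBasis_of_coeffs (by simp) fun v => ⟨0, Subsingleton.elim _ _⟩, by simp⟩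
      have hp : modPoly X ∅ I ∅ = 1 := by simp [modPoly, extSet]
      rw [hb, Set.image_singleton, hp]
      refine ⟨LinearIndepOn.singleton (by rw [hp]; exact one_ne_zero), fun p _ => ?_⟩
      rw [Submodule.mem_span_singleton]
      refine ⟨p.coeff 0, ?_⟩
      rw [MvPolynomial.eq_C_of_isEmpty p, MvPolynomial.smul_eq_C_mul]
      simp
    | succ n =>
      have hb : intBases X ∅ I = ∅ := by
        refine Set.eq_empty_of_forall_notMem fun B hB => ?_
        obtain ⟨b, hbB, -⟩ := exists_dotProduct_ne_zero_of_isColBasis hB.2.1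
          (one_ne_zero (α := Fin (n + 1) → ℝ))
        exact Finset.notMem_empty b (hB.1 hbB)
      rw [hb]
      refine ⟨linearIndepOn_empty _ _, fun p hp => ?_⟩
      -- No column is off `η^⊥`, so the condition reads `D_η^0 p = 0`.
      have := (hp 1 one_ne_zero).1
      simp only [offSet, Finset.filter_empty, Finset.card_empty, pow_zero,
        Module.End.one_apply] at this
      rw [this]
      exact Submodule.zero_mem _
  | insert a s ha ih =>
    have has : a ∉ s := fun h => lt_irrefl a (ha a h)
    have ih := fun {n : ℕ} => @ih (fun x hx => hlast x (Finset.mem_insert_of_mem hx)) n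
    intro n X
    by_cases hXa : X a = 0
    · rw [intBases_insert_of_eq_zero hXa, kerSpace_insert_of_eq_zero hXa]
      have heq : Set.EqOn (modPoly X s I) (modPoly X (insert a s) I) (intBases X s I) :=
        fun B hB => (modPoly_insert_of_eq_zero hB.2.1 hXa).symm
      rw [← heq.image_eq]
      exact ⟨(ih X).1.congr heq, (ih X).2⟩
    · obtain ⟨n, rfl⟩ : ∃ k, n = k + 1 := by
        refine Nat.exists_eq_succ_of_ne_zero ?_
        rintro rfl
        exact hXa (Subsingleton.elim _ _)
      obtain ⟨π, hs, hπ⟩ := exists_linearMap_ker_eq_span_singleton hXa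
      set S : Set (Finset ι) := {B | B ∈ intBases X (insert a s) I ∧ a ∈ B} with hS
      have hsplit : intBases X (insert a s) I = intBases X s I ∪ S := by
        ext B
        by_cases haB : a ∈ B
        · have : B ∉ intBases X s I := fun h => has (h.1 haB)
          simp [hS, haB, this]
        · simp [hS, haB, mem_intBases_insert_iff ha haB]
      have hdel : ∀ B ∈ intBases X s I,
          modPoly X (insert a s) I B = linForm (X a) * modPoly X s I B := fun B hB =>
        modPoly_insert ha hB.1 hB.2.1 hXa
      have hcon : ∀ B ∈ S, formMap π (modPoly X (insert a s) I B) =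
          modPoly (fun x => π (X x)) s I (B.erase a) := fun B hB =>
        formMap_modPoly ha hs hπ hB.2 hB.1.2.1
      have hpa : formMap π (linForm (X a)) = 0 := by
        rw [formMap_linForm, map_eq_zero_of_ker_eq hπ, linForm_zero]
      obtain ⟨hli, hsp⟩ := ih X
      obtain ⟨hli', hsp'⟩ := ih fun x => π (X x)
      constructor
      · rw [hsplit]
        refine linearIndepOn_union_of_map (formMap π).toLinearMap ?_ ?_ ?_
        · refine (hli.map_injOn (LinearMap.mulLeft ℂ (linForm (X a)))
            (mul_right_injective₀ (linForm_ne_zero hXa)).injOn).congr fun B hB => ?_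
          exact (hdel B hB).symm
        · have himg : (fun B : Finset ι => B.erase a) '' S ⊆
              intBases (fun x => π (X x)) s I := by
            rintro _ ⟨B, hB, rfl⟩
            exact ((mem_intBases_erase_iff hs hπ hB.2 hB.1.2.1).mp hB.1).1
          refine ((hli'.mono himg).comp_of_image fun B hB C hC h => ?_).congr fun B hB => ?_
          · rw [← Finset.insert_erase hB.2, ← Finset.insert_erase hC.2]
            exact congrArg (insert a) h
          · exact (hcon B hB).symm
        · intro B hB
          simp [hdel B hB, hpa]
      · intro p hp
        by_cases hp0 : p = 0
        · rw [hp0]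
          exact Submodule.zero_mem _
        -- Every internal basis of the contraction lifts by adding `a`: the lift can fail to be
        -- internal only if `a` is active, and this would force `p = 0`.
        have himg : modPoly (fun x => π (X x)) s I '' intBases (fun x => π (X x)) s I ⊆
            (formMap π).toLinearMap '' (modPoly X (insert a s) I '' S) := by
          rintro _ ⟨B, hB, rfl⟩
          have haB : a ∉ B := fun h => has (hB.1 h)
          have hbas := isColBasis_insert hπ hXa haB hB.2.1
          have haB' := Finset.mem_insert_self a B
          have hmem : insert a B ∈ S := by
            refine ⟨(mem_intBases_erase_iff hs hπ haB' hbas).mpr ⟨?_, fun haI hg => ?_⟩, haB'⟩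
            · rwa [Finset.erase_insert haB]
            · exact hp0 (eq_zero_of_isGreatest_cocircuit ha hbas haB' haI hg hp)
          refine ⟨_, ⟨_, hmem, rfl⟩, ?_⟩
          simpa [Finset.erase_insert haB] using hcon _ hmem
        have h1 := Submodule.span_mono himg (hsp' (formMap_mem_kerSpace hs hπ hp))
        rw [Submodule.span_image] at h1
        obtain ⟨g, hg, hgp⟩ := h1
        replace hgp : formMap π g = formMap π p := hgp
        have hSsub : S ⊆ intBases X (insert a s) I := fun B hB => hB.1
        -- The lift `g` must itself satisfy the differential conditions, so that `p - g` can be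
        -- divided by `p_a` inside the kernel spaces.
        have hgk : g ∈ kerSpace X (insert a s) I := by
          refine (Submodule.span_le.mpr ?_ : Submodule.span ℂ _ ≤ _) hg
          rintro _ ⟨B, hB, rfl⟩
          exact modPoly_mem_kerSpace hlast hB.1
        obtain ⟨q, hq⟩ := linForm_dvd_of_formMap_eq_zero π hs hπ
          (q := p - g) (by rw [map_sub, hgp, sub_self])
        have hqk : q ∈ kerSpace X s I := mem_kerSpace_of_linForm_mul ha hXa (by
          rw [← hq]; exact Submodule.sub_mem _ hp hgk)
        have hpg : p = LinearMap.mulLeft ℂ (linForm (X a)) q + g := by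
          rw [LinearMap.mulLeft_apply, ← hq, sub_add_cancel]
        rw [hpg]
        refine Submodule.add_mem _ ?_ (Submodule.span_mono (Set.image_mono hSsub) hg)
        have h2 := Submodule.mem_map_of_mem (f := LinearMap.mulLeft ℂ (linForm (X a))) (hsp hqk)
        rw [← Submodule.span_image] at h2
        refine Submodule.span_mono ?_ h2
        rintro _ ⟨_, ⟨B, hB, rfl⟩, rfl⟩
        exact ⟨B, hsplit ▸ Or.inl hB, hdel B hB⟩

end Induction

/-! ### The central and semi-internal spaces as kernel spaces. -/

section Relative

variable {n : ℕ} {ι : Type*} [LinearOrder ι] {X : ι → Fin n → ℝ} {A I B : Finset ι}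

lemma offSet_erase (b : ι) (η : Fin n → ℝ) :
    offSet X (A.erase b) η = (offSet X A η).erase b := by
  rw [offSet, offSet, Finset.filter_erase]

lemma modCol_of_badSet_eq_empty {w : ι} (h : badSet X A I B w = ∅) :
    modCol X A I B w = X w := by
  rw [modCol, h, Finset.sum_empty, sub_zero]

lemma modPoly_empty : modPoly X A ∅ B = prodForm X (extSet X A B) :=
  Finset.prod_congr rfl fun w _ => by
    rw [modCol_of_badSet_eq_empty]
    refine Finset.eq_empty_of_forall_notMem fun b hb => ?_
    exact Finset.notMem_empty w (mem_badSet.mp hb).2.1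

lemma dotProduct_eq_zero_of_mem_colSpan {κ : Type*} {X : κ → Fin n → ℝ} {η v : Fin n → ℝ}
    {S : Set κ}
    (h : ∀ y ∈ S, η ⬝ᵥ X y = 0) (hv : v ∈ colSpan X S) : η ⬝ᵥ v = 0 := by
  rw [colSpan] at hv
  induction hv using Submodule.span_induction with
  | mem x hx =>
    obtain ⟨y, hy, rfl⟩ := hx
    exact h y hy
  | zero => simp
  | add x y _ _ hx hy => rw [dotProduct_add, hx, hy, add_zero]
  | smul c x _ hx => rw [dotProduct_smul, hx, smul_zero]

/-- The columns of `A \ Y` span, so at least one column off `η^⊥` is not a factor of `p_Y`.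
Conversely, nothing is modified for `I = ∅`, and the spanning polynomials `p_Y`, with `Y` external
to `B`, leave `B` in `A \ Y`. -/
theorem centralSpace_eq_kerSpace (X : ι → Fin n → ℝ) (A : Finset ι) :
    centralSpace X A = kerSpace X A ∅ := by
  apply le_antisymm
  · refine Submodule.span_le.mpr ?_
    rintro _ ⟨Y, hYA, hY, rfl⟩ η hη
    refine ⟨dirEnd_pow_prod_eq_zero η X Y ?_, fun ⟨w, hw, _⟩ => absurd hw (Finset.notMem_empty w)⟩
    obtain ⟨y, hy, hyη⟩ : ∃ y ∈ A \ Y, η ⬝ᵥ X y ≠ 0 := by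
      by_contra! h
      refine hη (dotProduct_self_eq_zero.mp (dotProduct_eq_zero_of_mem_colSpan
        (S := (↑(A \ Y) : Set ι)) (X := X) (fun y hy => h y (by exact_mod_cast hy)) ?_))
      rw [hY]
      trivial
    obtain ⟨hyA, hyY⟩ := Finset.mem_sdiff.mp hy
    refine Finset.card_lt_card ⟨fun z hz => ?_, fun h => ?_⟩
    · obtain ⟨hzY, hz⟩ := Finset.mem_filter.mp hz
      exact mem_offSet.mpr ⟨hYA hzY, hz⟩
    · exact hyY (Finset.mem_filter.mp (h (mem_offSet.mpr ⟨hyA, hyη⟩))).1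
  · refine (linearIndepOn_modPoly_and_kerSpace_le_span A ∅ (by simp) X).2.trans
      (Submodule.span_mono ?_)
    rintro _ ⟨B, hB, rfl⟩
    refine ⟨extSet X A B, fun y hy => (mem_extSet.mp hy).1, ?_, modPoly_empty⟩
    refine top_le_iff.mp ?_
    rw [← hB.2.1.2]
    refine Submodule.span_mono (Set.image_mono fun b hb => ?_)
    simpa using ⟨hB.1 hb, fun h => notMem_of_mem_extSet h hb⟩

theorem semiInternalSpace_eq_kerSpace [Fintype ι] (X : ι → Fin n → ℝ) (I : Finset ι)
    (hlast : ∀ x, x ∉ I → ∀ y ∈ I, x < y) :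
    semiInternalSpace X I = kerSpace X Finset.univ I := by
  simp only [semiInternalSpace, centralSpace_eq_kerSpace]
  ext p
  simp only [Submodule.mem_inf, Submodule.mem_iInf]
  constructor
  · rintro ⟨h, hI⟩ η hη
    refine ⟨(h η hη).1, ?_⟩
    rintro ⟨w, hwI, hw⟩
    have := (hI w hwI η hη).1
    rwa [offSet_erase, Finset.card_erase_of_mem (by exact_mod_cast hw.1)] at this
  · refine fun h => ⟨fun η hη => ⟨(h η hη).1, fun ⟨w, hw, _⟩ => absurd hw (Finset.notMem_empty w)⟩,
      fun b hb η hη => ⟨?_, fun ⟨w, hw, _⟩ => absurd hw (Finset.notMem_empty w)⟩⟩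
    rw [offSet_erase]
    by_cases hbη : b ∈ offSet X Finset.univ η
    · rw [Finset.card_erase_of_mem hbη]
      -- The last column off `η^⊥` does not precede `b ∈ I`, so it is in `I`, and the stronger
      -- condition applies.
      have hg := (offSet X Finset.univ η).isGreatest_max' ⟨b, hbη⟩
      refine (h η hη).2 ⟨_, ?_, hg⟩
      by_contra hn
      exact absurd (hlast _ hn b hb) (not_lt.mpr (hg.2 (by exact_mod_cast hbη)))
    · rw [Finset.erase_eq_of_notMem hbη]
      exact (h η hη).1

lemma coeffs_sum_of_subset (hB : IsColBasis X B) {T : Finset ι} (hT : T ⊆ B) (a : ι → ℝ) (b : ι) :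
    coeffs X B (∑ x ∈ T, a x • X x) b = if b ∈ T then a b else 0 := by
  rw [coeffs_eq hB (c := fun b => if b ∈ T then a b else 0)]
  · exact fun b hb => if_neg fun h => hb (hT h)
  · simp only [ite_smul, zero_smul]
    rw [← Finset.sum_filter, Finset.filter_mem_eq_inter, Finset.inter_eq_right.mpr hT]

lemma badSet_subset (A : Finset ι) (w : ι) : badSet X A I B w ⊆ B :=
  fun _ hb => (mem_badSet.mp hb).1

end Relative

/-! ### From facet hyperplanes to coordinates in `B`. -/

section Translation

variable {n : ℕ} {ι : Type*} [Fintype ι] [LinearOrder ι] {X : ι → Fin n → ℝ} {I B : Finset ι}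

lemma isLastOff_colSpan_erase_iff (hB : IsColBasis X B) {b : ι} (hb : b ∈ B) (w : ι) :
    IsLastOff X (colSpan X (↑(B.erase b) : Set ι)) w ↔
      IsGreatest (↑(cocircuit X Finset.univ B b) : Set ι) w := by
  have : {x | X x ∉ colSpan X (↑(B.erase b) : Set ι)} = ↑(cocircuit X Finset.univ B b) := by
    ext x
    simp only [Set.mem_ofPred_eq, mem_colSpan_erase_iff hB hb, Finset.mem_coe, mem_cocircuit,
      Finset.mem_univ, true_and, ne_eq]
  rw [IsLastOff, this]

lemma internalBases_eq : internalBases X I = intBases X Finset.univ I := by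
  ext B
  simp only [internalBases, intBases, IsInternallyActive, Set.mem_ofPred_eq, Finset.subset_univ,
    true_and]
  refine and_congr_right fun hB => forall₂_congr fun b hb => ?_
  rw [isLastOff_colSpan_erase_iff hB hb, not_and]

lemma externalSet_eq (hB : IsColBasis X B) : externalSet X B = extSet X Finset.univ B := by
  ext x
  simp only [externalSet, Finset.mem_filter, Finset.mem_univ, true_and, mem_extSet]
  refine and_congr_right fun hx => ?_
  rw [mem_colSpan_iff_coeffs hB (fun b hb => hb.1)]
  push Not
  refine exists_congr fun b => and_congr_right fun hb => and_congr_left fun _ => ?_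
  simp only [Set.mem_ofPred_eq, not_and, not_lt]
  constructor
  · exact fun h => lt_of_le_of_ne (h hb) (by rintro rfl; exact hx hb)
  · exact fun h _ => h.le

lemma finrank_add_one_of_forall_mem_iff {F : Submodule ℝ (Fin n → ℝ)} {η : Fin n → ℝ} (hη : η ≠ 0)
    (h : ∀ v, v ∈ F ↔ η ⬝ᵥ v = 0) : Module.finrank ℝ F + 1 = n := by
  let f : Module.Dual ℝ (Fin n → ℝ) :=
    { toFun := fun v => η ⬝ᵥ v
      map_add' := fun v w => dotProduct_add _ _ _
      map_smul' := fun c v => dotProduct_smul _ _ _ }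
  have hf : f ≠ 0 := fun h0 => hη (dotProduct_self_eq_zero.mp (LinearMap.congr_fun h0 η))
  have hF : F = LinearMap.ker f := by
    ext v
    exact h v
  rw [hF, Module.Dual.finrank_ker_add_one_of_ne_zero hf, Module.finrank_fin_fun]

lemma mem_iff_dotProduct_eq_zero {F : Submodule ℝ (Fin n → ℝ)} {η : Fin n → ℝ} (hη : η ≠ 0)
    (hF : Module.finrank ℝ F + 1 = n) (h : ∀ v ∈ F, η ⬝ᵥ v = 0) (v : Fin n → ℝ) :
    v ∈ F ↔ η ⬝ᵥ v = 0 := by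
  let G : Submodule ℝ (Fin n → ℝ) :=
    { carrier := {v | η ⬝ᵥ v = 0}
      add_mem' := fun {v w} hv hw => by
        rw [Set.mem_ofPred_eq] at hv hw ⊢
        rw [dotProduct_add, hv, hw, add_zero]
      zero_mem' := dotProduct_zero _
      smul_mem' := fun c v hv => by
        rw [Set.mem_ofPred_eq] at hv ⊢
        rw [dotProduct_smul, hv, smul_zero] }
  have hG : ∀ v, v ∈ G ↔ η ⬝ᵥ v = 0 := fun v => Iff.rfl
  have := finrank_add_one_of_forall_mem_iff hη hG
  have hFG : F = G := Submodule.eq_of_le_of_finrank_eq (fun v hv => h v hv) (by omega)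
  rw [hFG, hG]

lemma multiplicity_eq {κ : Type*} [Fintype κ] {X : κ → Fin n → ℝ}
    {F : Submodule ℝ (Fin n → ℝ)} {η : Fin n → ℝ}
    (h : ∀ v, v ∈ F ↔ η ⬝ᵥ v = 0) : multiplicity X F = (offSet X Finset.univ η).card := by
  rw [multiplicity, ← Set.ncard_coe_finset]
  congr 1
  ext x
  simp [mem_offSet, h]

/-- The derivative of order `m(F) - 1` is nonzero iff at most one column off `F` is missing from
`X(B)`. Since `B` spans and is disjoint from `X(B)`, the missing column exists and is some `b ∈ B`;
the rest of `B` then lies in `F`. -/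
lemma mem_badFacets_iff (hX0 : ∀ x, X x ≠ 0) (hB : IsColBasis X B)
    (F : Submodule ℝ (Fin n → ℝ)) : F ∈ badFacets X I B ↔
      ∃ w, ∃ b ∈ badSet X Finset.univ I B w, F = colSpan X (↑(B.erase b) : Set ι) := by
  constructor
  · rintro ⟨⟨-, hF⟩, ⟨w, hwI, hw⟩, η, hη, hηF, hD⟩
    have hmem := mem_iff_dotProduct_eq_zero hη hF hηF
    rw [multiplicity_eq hmem, polyQ, externalSet_eq hB, ← funext (dirEnd_apply η),
      ← Module.End.pow_apply] at hD
    have hcard : (offSet X Finset.univ η).card ≤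
        ((extSet X Finset.univ B).filter fun z => η ⬝ᵥ X z ≠ 0).card + 1 := by
      by_contra h
      exact hD (dirEnd_pow_prod_eq_zero η X _ (by omega))
    obtain ⟨b, hb, hbη⟩ := exists_dotProduct_ne_zero_of_isColBasis hB hη
    have hbE : b ∉ (extSet X Finset.univ B).filter fun z => η ⬝ᵥ X z ≠ 0 := fun h =>
      notMem_of_mem_extSet (Finset.mem_filter.mp h).1 hb
    have hoff : insert b ((extSet X Finset.univ B).filter fun z => η ⬝ᵥ X z ≠ 0) =
        offSet X Finset.univ η := by
      refine Finset.eq_of_subset_of_card_le ?_ (by rwa [Finset.card_insert_of_notMem hbE])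
      intro y hy
      obtain rfl | hy := Finset.mem_insert.mp hy
      · exact mem_offSet.mpr ⟨Finset.mem_univ _, hbη⟩
      · exact mem_offSet.mpr ⟨Finset.mem_univ _, (Finset.mem_filter.mp hy).2⟩
    have hall : ∀ y, η ⬝ᵥ X y ≠ 0 → y ≠ b → y ∈ extSet X Finset.univ B := by
      intro y hy hyb
      have : y ∈ offSet X Finset.univ η := mem_offSet.mpr ⟨Finset.mem_univ _, hy⟩
      rw [← hoff] at this
      exact (Finset.mem_filter.mp ((Finset.mem_insert.mp this).resolve_left hyb)).1
    have hdot : ∀ v, η ⬝ᵥ v = coeffs X B v b * (η ⬝ᵥ X b) := by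
      intro v
      rw [dotProduct_eq_sum_coeffs hB, Finset.sum_eq_single b]
      · intro b' hb' hne
        by_cases h : η ⬝ᵥ X b' = 0
        · rw [h, mul_zero]
        · exact (notMem_of_mem_extSet (hall b' h hne) hb').elim
      · exact fun h => (h hb).elim
    have hFb : F = colSpan X (↑(B.erase b) : Set ι) := by
      ext v
      rw [hmem, mem_colSpan_erase_iff hB hb, hdot, mul_eq_zero, or_iff_left hbη]
    subst hFb
    refine ⟨w, b, mem_badSet.mpr ⟨hb, hwI, (isLastOff_colSpan_erase_iff hB hb w).mp hw, ?_⟩, rfl⟩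
    intro y hy hyb
    refine hall y ?_ hyb
    rw [hdot]
    exact mul_ne_zero (mem_cocircuit.mp hy).2 hbη
  · rintro ⟨w, b, hb, rfl⟩
    obtain ⟨hbB, hwI, hw, hext⟩ := mem_badSet.mp hb
    obtain ⟨η, hη⟩ := exists_dotProduct_eq_coeffs hB b
    have hη0 : η ≠ 0 := by
      rintro rfl
      have := hη (X b)
      simp [coeffs_self hB hbB] at this
    have hmem : ∀ v, v ∈ colSpan X (↑(B.erase b) : Set ι) ↔ η ⬝ᵥ v = 0 := fun v => by
      rw [mem_colSpan_erase_iff hB hbB, hη]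
    refine ⟨⟨⟨_, rfl⟩, finrank_add_one_of_forall_mem_iff hη0 hmem⟩,
      ⟨w, hwI, (isLastOff_colSpan_erase_iff hB hbB w).mpr hw⟩, η, hη0,
      fun v hv => (hmem v).mp hv, ?_⟩
    rw [multiplicity_eq hmem, polyQ, externalSet_eq hB, ← funext (dirEnd_apply η),
      ← Module.End.pow_apply]
    refine dirEnd_pow_prod_ne_zero η X _ (fun i _ => hX0 i) ?_
    rw [Nat.sub_le_iff_le_add]
    refine le_trans (Finset.card_le_card ?_) (Finset.card_insert_le b _)
    intro y hy
    rw [Finset.mem_insert, Finset.mem_filter]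
    refine or_iff_not_imp_left.mpr fun hyb => ⟨hext y ?_ hyb, (mem_offSet.mp hy).2⟩
    exact mem_cocircuit.mpr ⟨Finset.mem_univ _, by rw [← hη]; exact (mem_offSet.mp hy).2⟩

lemma setOf_notMem_eq_singleton (hB : IsColBasis X B) {w b : ι}
    (hb : b ∈ badSet X Finset.univ I B w) :
    {y | y ∉ externalSet X B ∧ X y ∉ colSpan X (↑(B.erase b) : Set ι)} = {b} := by
  obtain ⟨hbB, -, -, hext⟩ := mem_badSet.mp hb
  ext y
  simp only [Set.mem_ofPred_eq, Set.mem_singleton_iff, externalSet_eq hB,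
    mem_colSpan_erase_iff hB hbB]
  constructor
  · rintro ⟨hy, hc⟩
    by_contra hyb
    exact hy (hext y (mem_cocircuit.mpr ⟨Finset.mem_univ _, hc⟩) hyb)
  · rintro rfl
    exact ⟨fun h => notMem_of_mem_extSet h hbB, by simp [coeffs_self hB hbB]⟩

lemma mem_setW_iff (hX0 : ∀ x, X x ≠ 0) (hB : IsColBasis X B) {w : ι} :
    w ∈ setW X I B ↔ (badSet X Finset.univ I B w).Nonempty := by
  simp only [setW, Finset.mem_filter, Finset.mem_univ, true_and, mem_badFacets_iff hX0 hB]
  constructor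
  · rintro ⟨_, ⟨w', b, hb, rfl⟩, hw⟩
    obtain ⟨hbB, -, hg, -⟩ := mem_badSet.mp hb
    obtain rfl := hg.unique ((isLastOff_colSpan_erase_iff hB hbB w).mp hw)
    exact ⟨b, hb⟩
  · rintro ⟨b, hb⟩
    exact ⟨_, ⟨w, b, hb, rfl⟩,
      (isLastOff_colSpan_erase_iff hB (mem_badSet.mp hb).1 w).mpr (mem_badSet.mp hb).2.2.1⟩

lemma setXF_eq (hX0 : ∀ x, X x ≠ 0) (hB : IsColBasis X B) (w : ι) :
    setXF X I B w = badSet X Finset.univ I B w := by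
  ext x
  simp only [setXF, Finset.mem_filter, Finset.mem_univ, true_and, mem_badFacets_iff hX0 hB]
  constructor
  · rintro ⟨_, ⟨w', b, hb, rfl⟩, hw, hx⟩
    obtain ⟨hbB, -, hg, -⟩ := mem_badSet.mp hb
    obtain rfl := hg.unique ((isLastOff_colSpan_erase_iff hB hbB w).mp hw)
    rw [setOf_notMem_eq_singleton hB hb, Set.singleton_eq_singleton_iff] at hx
    exact hx ▸ hb
  · intro hb
    exact ⟨_, ⟨w, x, hb, rfl⟩,
      (isLastOff_colSpan_erase_iff hB (mem_badSet.mp hb).1 w).mpr (mem_badSet.mp hb).2.2.1,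
      setOf_notMem_eq_singleton hB hb⟩

lemma mem_spaceS_iff (hX0 : ∀ x, X x ≠ 0) (hB : IsColBasis X B) {w : ι} {v : Fin n → ℝ} :
    v ∈ spaceS X I B w ↔
      ∀ u ≤ w, ∀ b ∈ badSet X Finset.univ I B u, coeffs X B v b = 0 := by
  simp only [spaceS, Submodule.mem_sInf, Set.mem_ofPred_eq, mem_badFacets_iff hX0 hB]
  constructor
  · intro h u hu b hb
    obtain ⟨hbB, -, hg, -⟩ := mem_badSet.mp hb
    rw [← mem_colSpan_erase_iff hB hbB]
    exact h _ ⟨⟨u, b, hb, rfl⟩, u, hu, (isLastOff_colSpan_erase_iff hB hbB u).mpr hg⟩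
  · rintro h _ ⟨⟨w', b, hb, rfl⟩, u, hu, hw⟩
    obtain ⟨hbB, -, hg, -⟩ := mem_badSet.mp hb
    obtain rfl := hg.unique ((isLastOff_colSpan_erase_iff hB hbB u).mp hw)
    rw [mem_colSpan_erase_iff hB hbB]
    exact h _ hu b hb

/-- `v ∈ spaceS` has no component along `badSet` of `w`, which forces `a` to be the coordinates of
`w` there. Conversely, components along `badSet` of an earlier `u` are absent from `w` already, as
`u` is last in those cocircuits. -/
lemma isModification_iff (hX0 : ∀ x, X x ≠ 0) (hB : IsColBasis X B) {w : ι} {v : Fin n → ℝ} :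
    IsModification X I B w v ↔ v = modCol X Finset.univ I B w := by
  rw [IsModification, mem_spaceS_iff hX0 hB, setXF_eq hX0 hB]
  constructor
  · rintro ⟨hv, a, -, h⟩
    have ha : ∀ b ∈ badSet X Finset.univ I B w, coeffs X B (X w) b = a b := by
      intro b hb
      rw [h, coeffs_add hB, Pi.add_apply, hv w le_rfl b hb,
        coeffs_sum_of_subset hB (badSet_subset _ w), if_pos hb, zero_add]
    rw [modCol, Finset.sum_congr rfl fun b hb => by rw [ha b hb], eq_sub_iff_add_eq]
    exact h.symm
  · rintro rfl
    refine ⟨fun u hu b hb => ?_, coeffs X B (X w), fun b hb => ?_, by simp [modCol]⟩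
    · have h : coeffs X B (X w) b = coeffs X B (modCol X Finset.univ I B w) b +
          if b ∈ badSet X Finset.univ I B w then coeffs X B (X w) b else 0 := by
        rw [← coeffs_sum_of_subset hB (badSet_subset _ w), ← Pi.add_apply, ← coeffs_add hB]
        simp [modCol]
      obtain hlt | rfl := hu.lt_or_eq
      · rw [if_neg fun hb' => hlt.ne (badSet_eq_of_mem hb hb'), add_zero] at h
        rw [← h, coeffs_eq_zero_of_lt hb hlt (Finset.mem_univ w)]
      · rw [if_pos hb] at h
        simpa using h
    · exact (mem_cocircuit.mp (by exact_mod_cast (mem_badSet.mp hb).2.2.1.1)).2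

lemma modVec_eq (hX0 : ∀ x, X x ≠ 0) (hB : IsColBasis X B) (w : ι) :
    modVec X I B w = modCol X Finset.univ I B w :=
  (isModification_iff hX0 hB).mp
    (Classical.epsilon_spec ⟨_, (isModification_iff hX0 hB).mpr rfl⟩)

lemma setW_subset (hX0 : ∀ x, X x ≠ 0) (hB : B ∈ intBases X Finset.univ I) :
    setW X I B ⊆ externalSet X B := by
  intro w hw
  obtain ⟨b, hb⟩ := (mem_setW_iff hX0 hB.2.1).mp hw
  rw [externalSet_eq hB.2.1]
  exact mem_extSet_of_mem_badSet hB hb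

lemma polyQmod_eq (hX0 : ∀ x, X x ≠ 0) (hB : B ∈ intBases X Finset.univ I) :
    polyQmod X I B = modPoly X Finset.univ I B := by
  rw [modPoly, ← externalSet_eq hB.2.1, ← Finset.prod_sdiff (setW_subset hX0 hB), polyQmod,
    prodForm]
  congr 1
  · refine Finset.prod_congr rfl fun z hz => ?_
    rw [modCol_of_badSet_eq_empty]
    have := (Finset.mem_sdiff.mp hz).2
    rwa [mem_setW_iff hX0 hB.2.1, Finset.not_nonempty_iff_eq_empty] at this
  · exact Finset.prod_congr rfl fun w _ => by rw [modVec_eq hX0 hB.2.1]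

end Translation

/-! ### Degrees and the Hilbert function. -/

lemma prod_linForm_isHomogeneous {n : ℕ} {ι : Type*} (v : ι → Fin n → ℝ) (s : Finset ι) :
    (∏ i ∈ s, linForm (v i)).IsHomogeneous s.card := by
  simpa using MvPolynomial.IsHomogeneous.prod s (fun i => linForm (v i)) (fun _ => 1)
    fun i _ => linForm_isHomogeneous (v i)

/-- Projection to degree `j` fixes the members of degree `j` and kills the others, so the degree `j`
part of the span is spanned by the former. -/
lemma finrank_span_inf_homogeneousSubmodule {σ K α : Type*} [Field K] [Finite α]
    {f : α → MvPolynomial σ K} {S : Set α} {d : α → ℕ} (hf : LinearIndepOn K f S)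
    (hd : ∀ x ∈ S, (f x).IsHomogeneous (d x)) (j : ℕ) :
    Module.finrank K ↥(Submodule.span K (f '' S) ⊓ MvPolynomial.homogeneousSubmodule σ K j) =
      {x | x ∈ S ∧ d x = j}.ncard := by
  have hspan : Submodule.span K (f '' S) ⊓ MvPolynomial.homogeneousSubmodule σ K j =
      Submodule.span K (f '' {x | x ∈ S ∧ d x = j}) := by
    apply le_antisymm
    · rintro p ⟨hp, hpj⟩
      have hpc : MvPolynomial.homogeneousComponent j p = p := by
        rw [MvPolynomial.homogeneousComponent_of_mem hpj, if_pos rfl]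
      have h := Submodule.mem_map_of_mem (f := MvPolynomial.homogeneousComponent j) hp
      rw [hpc, ← Submodule.span_image] at h
      refine Submodule.span_le.mpr ?_ h
      rintro _ ⟨_, ⟨x, hx, rfl⟩, rfl⟩
      rw [MvPolynomial.homogeneousComponent_of_mem (hd x hx)]
      split_ifs with hj
      · exact Submodule.subset_span ⟨x, ⟨hx, hj.symm⟩, rfl⟩
      · exact Submodule.zero_mem _
    · refine Submodule.span_le.mpr ?_
      rintro _ ⟨x, ⟨hx, rfl⟩, rfl⟩
      exact ⟨Submodule.subset_span ⟨x, hx, rfl⟩, hd x hx⟩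
  have hT : LinearIndepOn K f {x | x ∈ S ∧ d x = j} := hf.mono fun x hx => hx.1
  cases nonempty_fintype {x | x ∈ S ∧ d x = j}
  rw [hspan, Set.image_eq_range, finrank_span_eq_card hT, ← Nat.card_eq_fintype_card,
    Nat.card_coe_set_eq]

end

end Zonotopal

theorem mainTheorem5 {n : ℕ} {ι : Type*} [Fintype ι] [LinearOrder ι]
    (X : ι → Fin n → ℝ) (hX0 : ∀ x, X x ≠ 0)
    (hX : Submodule.span ℝ (Set.range X) = ⊤)
    (I : Finset ι) (hI : LinearIndepOn ℝ X (↑I : Set ι))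
    (hlast : ∀ x, x ∉ I → ∀ y ∈ I, x < y) :
    -- the Hilbert series
    (∀ j : ℕ,
      Module.finrank ℂ
          ↥(Zonotopal.semiInternalSpace X I ⊓ MvPolynomial.homogeneousSubmodule (Fin n) ℂ j) =
        {B | B ∈ Zonotopal.internalBases X I ∧ Zonotopal.val X B = j}.ncard) ∧
    -- the modified polynomials are well defined
    (∀ B ∈ Zonotopal.internalBases X I,
      (∀ F ∈ Zonotopal.badFacets X I B,
        ∃! x : ι, x ∉ Zonotopal.externalSet X B ∧ X x ∉ F) ∧
      Zonotopal.setW X I B ⊆ Zonotopal.externalSet X B ∧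
      ∀ w ∈ Zonotopal.setW X I B, ∃! v : Fin n → ℝ, Zonotopal.IsModification X I B w v) ∧
    -- the modified polynomials are homogeneous, of the same degrees as the original ones
    (∀ B ∈ Zonotopal.internalBases X I,
      (Zonotopal.polyQ X B).totalDegree = Zonotopal.val X B ∧
      (Zonotopal.polyQmod X I B).totalDegree = Zonotopal.val X B ∧
      (Zonotopal.polyQmod X I B).IsHomogeneous (Zonotopal.val X B)) ∧
    -- the modified polynomials form a basis
    LinearIndependent ℂ
      (fun B : ↥(Zonotopal.internalBases X I) => Zonotopal.polyQmod X I (↑B : Finset ι)) ∧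
    Submodule.span ℂ
      (Set.range fun B : ↥(Zonotopal.internalBases X I) =>
        Zonotopal.polyQmod X I (↑B : Finset ι)) =
      Zonotopal.semiInternalSpace X I := by
  open Zonotopal in
  have hlast' : ∀ x ∈ Finset.univ, x ∉ I → ∀ y ∈ I, x < y := fun x _ => hlast x
  obtain ⟨hli, hsp⟩ := linearIndepOn_modPoly_and_kerSpace_le_span Finset.univ I hlast' X
  have heq : Set.EqOn (modPoly X Finset.univ I) (polyQmod X I) (internalBases X I) := by
    intro B hB
    rw [internalBases_eq] at hB
    exact (polyQmod_eq hX0 hB).symm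
  rw [← internalBases_eq] at hli hsp
  have hli' : LinearIndepOn ℂ (polyQmod X I) (internalBases X I) := hli.congr heq
  have hspan : Submodule.span ℂ (polyQmod X I '' internalBases X I) = semiInternalSpace X I := by
    rw [semiInternalSpace_eq_kerSpace X I hlast, ← heq.image_eq]
    refine le_antisymm (Submodule.span_le.mpr ?_) hsp
    rintro _ ⟨B, hB, rfl⟩
    rw [internalBases_eq] at hB
    exact modPoly_mem_kerSpace hlast' hB
  have hhom : ∀ B ∈ internalBases X I, (polyQmod X I B).IsHomogeneous (val X B) := by
    intro B hB
    rw [← heq hB]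
    rw [internalBases_eq] at hB
    rw [val, externalSet_eq hB.2.1]
    exact prod_linForm_isHomogeneous _ _
  refine ⟨fun j => ?_, fun B hB => ?_, fun B hB => ⟨?_, ?_, hhom B hB⟩, hli', ?_⟩
  · rw [← hspan]
    exact finrank_span_inf_homogeneousSubmodule hli' hhom j
  · rw [internalBases_eq] at hB
    refine ⟨fun F hF => ?_, setW_subset hX0 hB, fun w _ =>
      ⟨_, (isModification_iff hX0 hB.2.1).mpr rfl, fun v hv =>
        (isModification_iff hX0 hB.2.1).mp hv⟩⟩
    obtain ⟨w, b, hb, rfl⟩ := (mem_badFacets_iff hX0 hB.2.1 F).mp hF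
    have h := setOf_notMem_eq_singleton hB.2.1 hb
    exact ⟨b, h.symm.subset rfl, fun y hy => h.subset hy⟩
  · refine (prod_linForm_isHomogeneous X (externalSet X B)).totalDegree ?_
    exact Finset.prod_ne_zero_iff.mpr fun i _ => linForm_ne_zero (hX0 i)
  -- That no factor `p_{w'}` vanishes is obtained from linear independence.
  · exact (hhom B hB).totalDegree (hli'.ne_zero hB)
  · rw [← hspan, Set.image_eq_range]
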